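/- **Setting.** Fix $c\in(0,1)$ and an environment $\alpha=(\alpha(x))_{x\in\mathbb Z}$ with $\alpha(x)\in(c,1]$ for all $x$. Let $g:\mathbb N\to[0,\infty)$ be nondecreasing with $g(0)=0<g(1)\le\lim_{n\to\infty}g(n)=1$, and set $g(\infty)=1$. Let $p(\cdot)$ be a probability measure on $\mathbb Z$. The zero range process $(\eta^\alpha_t)_{t\ge0}$ started from $\eta_0$ is the càdlàg process on $\mathbf X=(\mathbb N\cup\{\infty\})^{\mathbb Z}$ (product topology) with $\eta^\alpha_0=\eta_0$ and with generator $$L^\alpha f(\eta)=\sum_{x,y\in\mathbb Z}\alpha(x)\,p(y-x)\,g(\eta(x))\,\bigl[f(\eta^{x,y})-f(\eta)\bigr],\qquad \eta^{x,y}=\eta-\delta_x+\delta_y\quad(\infty\pm1=\infty),$$ in the sense that $f(\eta^\alpha_t)-f(\eta^\alpha_0)-\int_0^tL^\alpha f(\eta^\alpha_s)\,ds$ is a martingale for every bounded cylinder function $f$, i.e. every bounded $f$ depending on finitely many coordinates. For $0\le\lambda<1$ let $\theta_\lambda(n)=Z(\lambda)^{-1}\lambda^n/\prod_{k=1}^n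 g(k)$, $n\in\mathbb N$, where $Z(\lambda)$ is the normalizing constant, and let $R(\lambda)=\sum_n n\,\theta_\lambda(n)$ be its mean. Let $\mu^\alpha_c$ be the product measure on $\mathbf X$ whose marginal at site $x$ is $\theta_{c/\alpha(x)}$. **Theorem.** Assume that 1. $\liminf_{x\to-\infty}\alpha(x)=c$; 2. the limit $\overline R(\lambda)=\lim_{n\to\infty}n^{-1}\sum_{x=-n}^{0}R(\lambda/\alpha(x))$ exists for every $\lambda\in[0,c)$; put $\rho_c=\lim_{\lambda\uparrow c}\overline R(\lambda)\in[0,\infty]$; 3. the jump kernel is totally asymmetric, i.e. $p(z)=0$ for all $z\le0$, and $p(1)<1$. Then there exists $\eta_0\in\mathbb N^{\mathbb Z}$ with $$\liminf_{n\to\infty}\frac1n\sum_{x=-n}^{-1}\eta_0(x)\ \ge\ \rho_c$$ such that the zero range process $\eta^\alpha_t$ started from $\eta_0$ does not converge in distribution to $\mu^\alpha_c$ as $t\to\infty$. -/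

import Mathlib

open MeasureTheory ProbabilityTheory Filter Topology
open scoped ENNReal NNReal

namespace ZeroRange

noncomputable section

/-- A zero range rate function: nondecreasing `g : ℕ → [0, ∞)` with
`g 0 = 0 < g 1 ≤ lim g = 1` (the limit being normalized to `1`). -/
structure RateFunction where
  rate : ℕ → ℝ
  monotone_rate : Monotone rate
  rate_zero : rate 0 = 0
  rate_one_pos : 0 < rate 1
  tendsto_rate : Tendsto rate atTop (𝓝 1)

/-- The extension of `g` to `ℕ ∪ {∞}` by `g ∞ = lim g = 1`. -/
def RateFunction.ext (g : RateFunction) (k : ℕ∞) : ℝ :=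
  if k = ⊤ then 1 else g.rate k.toNat

/-- An environment: a `(c, 1]`-valued family of site rates. -/
structure Environment (c : ℝ) where
  val : ℤ → ℝ
  mem_Ioc : ∀ x, val x ∈ Set.Ioc c 1

/-- Particle configurations, with values in `ℕ ∪ {∞}`; topology and σ-algebra are the product ones. -/
abbrev Config : Type := ℤ → ℕ∞

instance : OpensMeasurableSpace ℕ∞ := ⟨le_top⟩

instance : SecondCountableTopology ℕ∞ := by
  refine ⟨⟨{s : Set ℕ∞ | ∃ a, s = Set.Ioi a ∨ s = Set.Iio a}, ?_,
    OrderTopology.topology_eq_generate_intervals⟩⟩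
  refine ((Set.countable_range (fun a : ℕ∞ => Set.Ioi a)).union
    (Set.countable_range (fun a : ℕ∞ => Set.Iio a))).mono ?_
  rintro s ⟨a, rfl | rfl⟩
  · exact Or.inl ⟨a, rfl⟩
  · exact Or.inr ⟨a, rfl⟩

/-- The configuration `η - δ_x + δ_y` obtained from `η` when a particle jumps from `x` to `y`.
In `ℕ∞` one has `∞ - 1 = ∞ = ∞ + 1`, which gives the usual conventions at infinite sites.
Only used when `η x > 0`. -/
def jump (η : Config) (x y : ℤ) : Config := fun z =>
  η z - (if z = x then 1 else 0) + (if z = y then 1 else 0)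

/-- `f` is a cylinder function: it depends on finitely many coordinates. -/
def IsCylinder (f : Config → ℝ) : Prop :=
  ∃ s : Finset ℤ, DependsOn f (s : Set ℤ)

/-- The generator
`L f (η) = ∑_{x, y} α(x) p(y - x) g(η(x)) [f(η^{x,y}) - f(η)]`;
for a bounded cylinder function `f` the series converges absolutely. -/
def generator (g : RateFunction) {c : ℝ} (α : Environment c) (p : PMF ℤ)
    (f : Config → ℝ) (η : Config) : ℝ :=
  ∑' xy : ℤ × ℤ, α.val xy.1 * (p (xy.2 - xy.1)).toReal * g.ext (η xy.1) *
    (f (jump η xy.1 xy.2) - f η)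

/-- `η` is (a version of) the zero range process in the environment `α` started from `η₀`: a càdlàg
process, adapted to some filtration, with `η 0 = η₀` almost surely, which solves the martingale
problem for the generator on bounded cylinder functions. -/
structure IsZeroRangeProcess (g : RateFunction) {c : ℝ} (α : Environment c) (p : PMF ℤ)
    (η₀ : Config) {Ω : Type*} [mΩ : MeasurableSpace Ω] (P : Measure Ω)
    (η : ℝ≥0 → Ω → Config) : Prop where
  initial : ∀ᵐ ω ∂P, η 0 ω = η₀
  right_continuous : ∀ ω t, ContinuousWithinAt (fun s => η s ω) (Set.Ici t) t
  left_limits : ∀ ω t, ∃ ζ : Config, Tendsto (fun s => η s ω) (𝓝[<] t) (𝓝 ζ)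
  martingale_problem : ∃ ℱ : Filtration ℝ≥0 mΩ, Adapted ℱ η ∧
    ∀ f : Config → ℝ, IsCylinder f → (∃ K : ℝ, ∀ ζ, |f ζ| ≤ K) →
      Martingale (fun (t : ℝ≥0) ω => f (η t ω) - f (η 0 ω) -
        ∫ s in (0 : ℝ)..(t : ℝ), generator g α p f (η s.toNNReal ω)) ℱ P

/-- The weight `λ ^ n / g(n)!`, where `g(n)! = g(1) ⋯ g(n)`. -/
def weight (g : RateFunction) (lam : ℝ) (n : ℕ) : ℝ≥0∞ :=
  ENNReal.ofReal (lam ^ n / ∏ k ∈ Finset.Icc 1 n, g.rate k)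

/-- The normalizing factor `Z(λ)`. -/
def partitionFunction (g : RateFunction) (lam : ℝ) : ℝ≥0∞ := ∑' n : ℕ, weight g lam n

/-- The one-site measure `θ_λ`, `0 ≤ λ < 1`, viewed on `ℕ ∪ {∞}` (with no mass at `∞`). -/
def theta (g : RateFunction) (lam : ℝ) : Measure ℕ∞ :=
  Measure.sum fun n : ℕ => (weight g lam n / partitionFunction g lam) • Measure.dirac (n : ℕ∞)

lemma RateFunction.rate_pos (g : RateFunction) {k : ℕ} (hk : 1 ≤ k) : 0 < g.rate k :=
  g.rate_one_pos.trans_le (g.monotone_rate hk)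

lemma partitionFunction_ne_zero (g : RateFunction) (lam : ℝ) : partitionFunction g lam ≠ 0 := by
  intro h
  have := ENNReal.tsum_eq_zero.1 h 0
  simp [weight] at this

lemma partitionFunction_ne_top (g : RateFunction) {lam : ℝ} (h0 : 0 ≤ lam) (h1 : lam < 1) :
    partitionFunction g lam ≠ ⊤ := by
  have hprod : ∀ n : ℕ, 0 < ∏ k ∈ Finset.Icc 1 n, g.rate k := fun n =>
    Finset.prod_pos fun k hk => g.rate_pos (Finset.mem_Icc.1 hk).1
  have hs : Summable fun n : ℕ => lam ^ n / ∏ k ∈ Finset.Icc 1 n, g.rate k := by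
    rcases h0.eq_or_lt with rfl | hpos
    · refine summable_of_ne_finset_zero (s := {0}) fun n hn => ?_
      simp at hn
      simp [hn]
    · refine summable_of_ratio_test_tendsto_lt_one h1
        (Eventually.of_forall fun n => (div_pos (pow_pos hpos n) (hprod n)).ne') ?_
      have hlim : Tendsto (fun n : ℕ => lam / g.rate (n + 1)) atTop (𝓝 lam) := by
        have := (tendsto_const_nhds (x := lam)).div
          (g.tendsto_rate.comp (tendsto_add_atTop_nat 1)) one_ne_zero
        rw [div_one] at this
        exact this
      refine hlim.congr fun n => ?_
      have h2 := g.rate_pos (Nat.le_add_left 1 n)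
      rw [Real.norm_of_nonneg (div_pos (pow_pos hpos _) (hprod _)).le,
        Real.norm_of_nonneg (div_pos (pow_pos hpos _) (hprod _)).le,
        Finset.prod_Icc_succ_top (Nat.le_add_left 1 n)]
      have h3 := (hprod n).ne'
      have h4 := (pow_pos hpos n).ne'
      field_simp
      ring
  rw [partitionFunction]
  simp only [weight]
  rw [← ENNReal.ofReal_tsum_of_nonneg (fun n => div_nonneg (pow_nonneg h0 n) (hprod n).le) hs]
  exact ENNReal.ofReal_ne_top

lemma isProbabilityMeasure_theta (g : RateFunction) {lam : ℝ} (h0 : 0 ≤ lam) (h1 : lam < 1) :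
    IsProbabilityMeasure (theta g lam) := by
  constructor
  simp only [theta, Measure.sum_apply _ MeasurableSet.univ, Measure.smul_apply, measure_univ,
    smul_eq_mul, mul_one, div_eq_mul_inv]
  rw [ENNReal.tsum_mul_right]
  exact ENNReal.mul_inv_cancel (partitionFunction_ne_zero g lam) (partitionFunction_ne_top g h0 h1)

/-- The invariant measure `μ_λ^α`, `0 ≤ λ ≤ c`: the product measure on configurations with
marginal `θ_{λ / α(x)}` at site `x`. -/
def invariantMeasure (g : RateFunction) {c : ℝ} (hc : c ∈ Set.Ioo (0 : ℝ) 1) (α : Environment c)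
    (lam : ℝ) (hlam : lam ∈ Set.Icc 0 c) : ProbabilityMeasure Config :=
  ⟨Measure.infinitePi fun x => theta g (lam / α.val x), by
    have : ∀ x, IsProbabilityMeasure (theta g (lam / α.val x)) := fun x => by
      have hx := (α.mem_Ioc x).1
      have hpos : 0 < α.val x := hc.1.trans hx
      exact isProbabilityMeasure_theta g (div_nonneg hlam.1 hpos.le)
        ((div_lt_one hpos).2 (hlam.2.trans_lt hx))
    infer_instance⟩

/-- The mean `R(λ)` of `θ_λ`. -/
def meanDensity (g : RateFunction) (lam : ℝ) : ℝ≥0∞ :=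
  ∑' n : ℕ, (n : ℝ≥0∞) * (weight g lam n / partitionFunction g lam)

/-- The spatial average `n⁻¹ ∑_{x = -n}^0 R(λ / α(x))`. -/
def averageDensity (g : RateFunction) {c : ℝ} (α : Environment c) (lam : ℝ) (n : ℕ) : ℝ≥0∞ :=
  (∑ x ∈ Finset.Icc (-(n : ℤ)) 0, meanDensity g (lam / α.val x)) / n

/-- Existence of the annealed density to the left of the origin, for every `λ ∈ [0, c)`. -/
def HasAnnealedDensity (g : RateFunction) {c : ℝ} (α : Environment c) : Prop :=
  ∀ lam ∈ Set.Ico 0 c, ∃ r : ℝ≥0∞, Tendsto (averageDensity g α lam) atTop (𝓝 r)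

/-- The annealed density `λ ↦ lim_n n⁻¹ ∑_{x = -n}^0 R(λ / α(x))`. -/
def annealedDensity (g : RateFunction) {c : ℝ} (α : Environment c) (lam : ℝ) : ℝ≥0∞ :=
  limUnder atTop (averageDensity g α lam)

/-- The critical density `ρ_c ∈ [0, ∞]`: the left limit at `c` of the (nondecreasing) annealed
density. -/
def criticalDensity (g : RateFunction) {c : ℝ} (α : Environment c) : ℝ≥0∞ :=
  limUnder (𝓝[<] c) (annealedDensity g α)

/-- The supercriticality condition `liminf_n n⁻¹ ∑_{x = -n}^{-1} η₀(x) ≥ ρ_c`. -/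
def IsSupercritical (g : RateFunction) {c : ℝ} (α : Environment c) (η₀ : ℤ → ℕ) : Prop :=
  criticalDensity g α ≤
    liminf (fun n : ℕ => (∑ x ∈ Finset.Icc (-(n : ℤ)) (-1), (η₀ x : ℝ≥0∞)) / n) atTop

end

end ZeroRange

/-!
The initial configuration consists of isolated piles: `d k * d (k + 1)` particles at `-d k`, with
`d` growing very fast, and nothing elsewhere. A pile is as high as the distance to the next one
requires, and more, so that the density to the left of the origin is infinite (`piles`,
`tendsto_density_piles`). The sites of the piles are chosen among the almost slowest ones,
`α(-d k) → c` (`exists_pile_sites`).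

The contradiction comes from the flux through the origin. A site emits at most `α(-d k) ≈ c`
particles per unit time, however high the pile there is. In the state `μ_c^α`, on the other hand,
`α(x) E g(η(x)) = c` at every site (`lintegral_ext_theta`), so the particles jumping from `0` and from
`-1` across the origin already create a flux `c + c (1 - p(1)) > c`. This is where `p(1) < 1`
matters: a jump may pass over sites, so the equilibrium flux exceeds what a single pile can feed. By
time `T = (d k + 1) ^ 4` the piles to the right of `-d k`, which contain at most `(d k) ^ 3`
particles, contribute a negligible amount, and those to the left of `-d k` are so far away that only
boundedly many of their particles are expected to have come close. Hence the flux up to time `T` is at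
most `c T + o(T)` (`flux_le_of_piles`), which is incompatible with convergence to `μ_c^α`, since `g`
extends continuously to `ℕ ∪ {∞}` and the mean rates therefore converge (`tendsto_meanRate`).

The process is known only through its martingale problem, whose test functions are bounded cylinder
functions. All estimates come from one family of them, the number of particles in a finite set with
each site truncated at a level `K` (`boxCount`). Their mean evolution gives a balance of particles
(`IsZeroRangeProcess.boxCount_add_outflow_le`). For a single site, letting `K → ∞`, it gives a linear
integral inequality for the mean rates `E g(η_t(x))` (`IsZeroRangeProcess.meanRate_le`). Iterating it
excludes mass coming from infinity and bounds the influence of the far piles by the Green function of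
the jump kernel, which tends to zero (`IsZeroRangeProcess.meanRate_le_exp_mul`, `tendsto_green`). For
the interval `(-d k, 0]` the balance gives the bound on the flux (`IsZeroRangeProcess.flux_le`).
-/

namespace ZeroRange

noncomputable section

/-! ### Measurability of right-continuous paths -/

instance instBorelSpaceENat : BorelSpace ℕ∞ := by
  refine ⟨le_antisymm (fun s _ => ?_) le_top⟩
  rw [← Set.biUnion_of_singleton s]
  let _ : MeasurableSpace ℕ∞ := borel ℕ∞
  have : BorelSpace ℕ∞ := ⟨rfl⟩
  exact MeasurableSet.biUnion (Set.to_countable s) fun x _ => isClosed_singleton.measurableSet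

/-- A process with right-continuous paths is jointly measurable in time and randomness. -/
lemma measurable_uncurry_of_rightContinuous {Ω : Type*} [MeasurableSpace Ω]
    {η : ℝ≥0 → Ω → Config} (hm : ∀ t, Measurable (η t))
    (hr : ∀ ω t, ContinuousWithinAt (fun s => η s ω) (Set.Ici t) t) :
    Measurable fun q : ℝ≥0 × Ω => η q.1 q.2 := by
  refine measurable_pi_lambda _ fun x => ?_
  -- approximation of the time from the right along the grid of mesh `1 / (n + 1)`
  obtain ⟨ρ, hρ⟩ : ∃ ρ : ℕ → ℕ → ℝ≥0, ∀ n k, ρ n k = ((k : ℝ≥0) + 1) / ((n : ℝ≥0) + 1) :=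
    ⟨_, fun _ _ => rfl⟩
  let r : ℕ → ℝ≥0 → ℝ≥0 := fun n s => ρ n ⌊((n : ℝ≥0) + 1) * s⌋₊
  have hpos : ∀ n : ℕ, (0 : ℝ≥0) < (n : ℝ≥0) + 1 := fun n => by positivity
  have hle : ∀ n s, s ≤ r n s := fun n s => by
    simp only [r]
    rw [hρ, le_div_iff₀ (hpos n), mul_comm]
    exact (Nat.lt_floor_add_one _).le
  have hge : ∀ n s, r n s ≤ s + 1 / ((n : ℝ≥0) + 1) := fun n s => by
    simp only [r]
    rw [hρ, div_le_iff₀ (hpos n), add_mul s, one_div, inv_mul_cancel₀ (hpos n).ne', mul_comm s]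
    gcongr
    exact Nat.floor_le zero_le
  have hlim : ∀ s, Tendsto (fun n => r n s) atTop (𝓝[≥] s) := fun s => by
    refine tendsto_nhdsWithin_iff.2 ⟨?_, Eventually.of_forall fun n => hle n s⟩
    refine tendsto_of_tendsto_of_tendsto_of_le_of_le tendsto_const_nhds ?_
      (fun n => hle n s) (fun n => hge n s)
    simpa using (tendsto_const_nhds (x := s)).add
      (tendsto_one_div_add_atTop_nhds_zero_nat (𝕜 := ℝ≥0))
  refine measurable_of_tendsto_metrizable (f := fun n (q : ℝ≥0 × Ω) => η (r n q.1) q.2 x) ?_ ?_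
  · intro n
    have h1 : Measurable fun q : ℕ × Ω => η (ρ n q.1) q.2 x :=
      measurable_from_prod_countable_right fun k => (measurable_pi_apply x).comp (hm (ρ n k))
    have h2 : Measurable fun q : ℝ≥0 × Ω => (⌊((n : ℝ≥0) + 1) * q.1⌋₊, q.2) :=
      (Nat.measurable_floor.comp (measurable_const.mul measurable_fst)).prodMk measurable_snd
    exact h1.comp h2
  · refine tendsto_pi_nhds.2 fun q => ?_
    exact (tendsto_pi_nhds.1 ((hr q.2 q.1).tendsto.comp (hlim q.1))) x

/-! ### The extended rate function -/

lemma RateFunction.rate_le_one (g : RateFunction) (k : ℕ) : g.rate k ≤ 1 :=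
  g.monotone_rate.ge_of_tendsto g.tendsto_rate k

lemma RateFunction.rate_nonneg (g : RateFunction) (k : ℕ) : 0 ≤ g.rate k :=
  g.rate_zero ▸ g.monotone_rate (Nat.zero_le k)

lemma RateFunction.ext_natCast (g : RateFunction) (k : ℕ) : g.ext k = g.rate k := by
  simp [RateFunction.ext]

lemma RateFunction.ext_nonneg (g : RateFunction) (k : ℕ∞) : 0 ≤ g.ext k := by
  unfold RateFunction.ext
  split_ifs
  exacts [zero_le_one, g.rate_nonneg _]

lemma RateFunction.ext_le_one (g : RateFunction) (k : ℕ∞) : g.ext k ≤ 1 := by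
  unfold RateFunction.ext
  split_ifs
  exacts [le_rfl, g.rate_le_one _]

lemma RateFunction.ext_zero (g : RateFunction) : g.ext 0 = 0 := by
  simpa [g.rate_zero] using g.ext_natCast 0

lemma RateFunction.continuous_ext (g : RateFunction) : Continuous g.ext := by
  refine continuous_iff_continuousAt.2 fun k => ?_
  by_cases hk : k = ⊤
  · subst hk
    have htop : g.ext ⊤ = 1 := by simp [RateFunction.ext]
    rw [ContinuousAt, htop]
    refine tendsto_order.2 ⟨fun a ha => ?_, fun a ha =>
      Eventually.of_forall fun k => (g.ext_le_one k).trans_lt ha⟩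
    obtain ⟨N, hN⟩ := ((tendsto_order.1 g.tendsto_rate).1 a ha).exists
    filter_upwards [lt_mem_nhds (ENat.natCast_lt_top N)] with k hk
    induction k using ENat.recTopCoe with
    | top => rwa [htop]
    | coe k =>
      rw [g.ext_natCast]
      exact hN.trans_le (g.monotone_rate (by exact_mod_cast hk.le))
  · rw [ContinuousAt, ENat.nhds_eq_pure hk]
    exact tendsto_pure_nhds _ _

/-! ### Truncated particle numbers -/

/-- The particle number `k`, truncated at level `K`. -/
def cap (K : ℕ) (k : ℕ∞) : ℕ := (min k K).toNat

lemma cap_top (K : ℕ) : cap K ⊤ = K := by simp [cap]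

lemma cap_natCast (K k : ℕ) : cap K k = min k K := by
  have : min (k : ℕ∞) K = ((min k K : ℕ) : ℕ∞) := by norm_cast
  rw [cap, this, ENat.toNat_natCast]

lemma cap_le (K : ℕ) (k : ℕ∞) : cap K k ≤ K := by
  induction k using ENat.recTopCoe with
  | top => simp [cap_top]
  | coe k => simp [cap_natCast]

lemma cap_add_one_le (K : ℕ) (k : ℕ∞) : cap K (k + 1) ≤ cap K k + 1 := by
  induction k using ENat.recTopCoe with
  | top => simp [cap_top]
  | coe k =>
    have : (k : ℕ∞) + 1 = ((k + 1 : ℕ) : ℕ∞) := by norm_cast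
    rw [this, cap_natCast, cap_natCast]; omega

lemma le_cap_add_one (K : ℕ) (k : ℕ∞) : cap K k ≤ cap K (k + 1) := by
  induction k using ENat.recTopCoe with
  | top => simp [cap_top]
  | coe k =>
    have : (k : ℕ∞) + 1 = ((k + 1 : ℕ) : ℕ∞) := by norm_cast
    rw [this, cap_natCast, cap_natCast]; omega

lemma cap_sub_one_le (K : ℕ) (k : ℕ∞) : cap K (k - 1) ≤ cap K k := by
  induction k using ENat.recTopCoe with
  | top => simp [cap_top]
  | coe k =>
    have : (k : ℕ∞) - 1 = ((k - 1 : ℕ) : ℕ∞) := by norm_cast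
    rw [this, cap_natCast, cap_natCast]; omega

lemma cap_le_sub_one_add (K : ℕ) (k : ℕ∞) : cap K k ≤ cap K (k - 1) + 1 := by
  induction k using ENat.recTopCoe with
  | top => simp [cap_top]
  | coe k =>
    have : (k : ℕ∞) - 1 = ((k - 1 : ℕ) : ℕ∞) := by norm_cast
    rw [this, cap_natCast, cap_natCast]; omega

lemma cap_sub_one_add_one {K : ℕ} {k : ℕ∞} (h0 : k ≠ 0) (hK : k ≤ K) :
    cap K (k - 1) + 1 = cap K k := by
  induction k using ENat.recTopCoe with
  | top => simp at hK
  | coe k =>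
    have : (k : ℕ∞) - 1 = ((k - 1 : ℕ) : ℕ∞) := by norm_cast
    have hK' : k ≤ K := by exact_mod_cast hK
    have h0' : k ≠ 0 := by exact_mod_cast h0
    rw [this, cap_natCast, cap_natCast]; omega

/-- The number of particles in `A`, each site being truncated at level `K`. -/
def boxCount (A : Finset ℤ) (K : ℕ) (ζ : Config) : ℝ := ∑ x ∈ A, (cap K (ζ x) : ℝ)

lemma boxCount_nonneg (A : Finset ℤ) (K : ℕ) (ζ : Config) : 0 ≤ boxCount A K ζ :=
  Finset.sum_nonneg fun _ _ => Nat.cast_nonneg _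

lemma boxCount_le (A : Finset ℤ) (K : ℕ) (ζ : Config) : boxCount A K ζ ≤ A.card * K := by
  rw [boxCount, ← nsmul_eq_mul]
  exact Finset.sum_le_card_nsmul _ _ _ fun x _ => by exact_mod_cast cap_le K (ζ x)

lemma isCylinder_boxCount (A : Finset ℤ) (K : ℕ) : IsCylinder (boxCount A K) :=
  ⟨A, fun ζ ξ h => Finset.sum_congr rfl fun x hx => by rw [h x (by simpa using hx)]⟩

lemma measurable_jump (x y : ℤ) : Measurable fun ζ : Config => jump ζ x y :=
  measurable_pi_lambda _ fun z => (Measurable.of_discrete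
    (f := fun k : ℕ∞ => k - (if z = x then 1 else 0) + (if z = y then 1 else 0))).comp
    (measurable_pi_apply z)

lemma measurable_boxCount (A : Finset ℤ) (K : ℕ) : Measurable (boxCount A K) :=
  Finset.measurable_sum _ fun x _ => (Measurable.of_discrete
    (f := fun k : ℕ∞ => (cap K k : ℝ))).comp (measurable_pi_apply x)

/-- A jump changes the truncated count by at most one for each endpoint in `A`. -/
lemma abs_boxCount_jump_sub_le (A : Finset ℤ) (K : ℕ) (ζ : Config) (x y : ℤ) :
    |boxCount A K (jump ζ x y) - boxCount A K ζ| ≤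
      (if x ∈ A then 1 else 0) + (if y ∈ A then 1 else 0) := by
  rw [boxCount, boxCount, ← Finset.sum_sub_distrib]
  refine (Finset.abs_sum_le_sum_abs _ _).trans ?_
  have : ∀ z ∈ A, |(cap K (jump ζ x y z) : ℝ) - cap K (ζ z)| ≤
      (if x = z then 1 else 0) + (if y = z then 1 else 0) := by
    intro z _
    have h1 := cap_add_one_le K (ζ z)
    have h2 := le_cap_add_one K (ζ z)
    have h3 := cap_sub_one_le K (ζ z)
    have h4 := cap_le_sub_one_add K (ζ z)
    have h5 := cap_add_one_le K (ζ z - 1)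
    have h6 := le_cap_add_one K (ζ z - 1)
    simp only [jump, eq_comm (a := z)]
    rw [abs_le]
    rify at h1 h2 h3 h4 h5 h6
    split_ifs <;> (try simp only [tsub_zero, add_zero]) <;> constructor <;> linarith
  refine (Finset.sum_le_sum this).trans (le_of_eq ?_)
  rw [Finset.sum_add_distrib, Finset.sum_ite_eq, Finset.sum_ite_eq]

/-- A jump adds at most one particle to `A`, and removes one whenever it starts from a
non-truncated site of `A`. -/
lemma boxCount_jump_sub_le (A : Finset ℤ) (K : ℕ) {ζ : Config} {x y : ℤ} (hxy : x ≠ y)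
    (hx : ζ x ≠ 0) :
    boxCount A K (jump ζ x y) - boxCount A K ζ ≤
      (if y ∈ A then 1 else 0) - (if x ∈ A then (if ζ x ≤ K then 1 else 0) else 0) := by
  rw [boxCount, boxCount, ← Finset.sum_sub_distrib]
  have : ∀ z ∈ A, (cap K (jump ζ x y z) : ℝ) - cap K (ζ z) ≤
      (if y = z then 1 else 0) - (if x = z then (if ζ x ≤ K then 1 else 0) else 0) := by
    intro z _
    simp only [jump, eq_comm (a := z)]
    by_cases hxz : x = z
    · subst hxz
      have h3 := cap_sub_one_le K (ζ x)
      rw [if_pos rfl, if_neg hxy.symm, if_neg hxy.symm, if_pos rfl, add_zero]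
      split_ifs with hK
      · have h4 := cap_sub_one_add_one hx hK
        rify at h4; linarith
      · rify at h3; linarith
    · rw [if_neg hxz, if_neg hxz, tsub_zero]
      split_ifs
      · have h1 := cap_add_one_le K (ζ z)
        rify at h1; linarith
      · simp
  refine (Finset.sum_le_sum this).trans (le_of_eq ?_)
  rw [Finset.sum_sub_distrib, Finset.sum_ite_eq, Finset.sum_ite_eq]

/-! ### The generator on truncated particle numbers -/

lemma hasSum_toReal (p : PMF ℤ) : HasSum (fun z => (p z).toReal) 1 := by
  have h := ENNReal.hasSum_toReal (f := p) (by simp [p.tsum_coe])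
  rwa [← ENNReal.tsum_toReal_eq p.apply_ne_top, p.tsum_coe, ENNReal.toReal_one] at h

/-- Summation of the jump probabilities out of the sites of `A`, with weights `b`. -/
lemma hasSum_row (p : PMF ℤ) (A : Finset ℤ) (b : ℤ → ℝ) :
    HasSum (fun q : ℤ × ℤ => if q.1 ∈ A then b q.1 * (p (q.2 - q.1)).toReal else 0)
      (∑ x ∈ A, b x) := by
  have h : ∀ x ∈ A, HasSum (fun q : ℤ × ℤ =>
      if q.1 = x then b q.1 * (p (q.2 - q.1)).toReal else 0) (b x) := by
    intro x _
    have hinj : Function.Injective fun y : ℤ => (x, y) := fun y y' h => (Prod.ext_iff.1 h).2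
    refine (hinj.hasSum_iff ?_).1 ?_
    · rintro ⟨x', y⟩ hq
      refine if_neg fun h => hq ⟨y, ?_⟩
      simp only at h
      rw [h]
    · have := ((Equiv.subRight x).hasSum_iff.2 (hasSum_toReal p)).mul_left (b x)
      simpa [Function.comp_def] using this
  refine (hasSum_sum h).congr_fun ?_
  intro q
  simp

/-- Summation of the jump probabilities into the sites of `A`, with weights `b`. -/
lemma hasSum_col (p : PMF ℤ) (A : Finset ℤ) (b : ℤ → ℝ) {B : ℝ} (hb : ∀ x, |b x| ≤ B) :
    HasSum (fun q : ℤ × ℤ => if q.2 ∈ A then b q.1 * (p (q.2 - q.1)).toReal else 0)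
      (∑ y ∈ A, ∑' x, b x * (p (y - x)).toReal) := by
  have h : ∀ y ∈ A, HasSum (fun q : ℤ × ℤ =>
      if q.2 = y then b q.1 * (p (q.2 - q.1)).toReal else 0)
      (∑' x, b x * (p (y - x)).toReal) := by
    intro y _
    have hinj : Function.Injective fun x : ℤ => (x, y) := fun y y' h => (Prod.ext_iff.1 h).1
    refine (hinj.hasSum_iff ?_).1 ?_
    · rintro ⟨x, y'⟩ hq
      refine if_neg fun h => hq ⟨x, ?_⟩
      simp only at h
      rw [h]
    · have h1 : Summable fun x => B * (p (y - x)).toReal :=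
        ((Equiv.subLeft y).summable_iff.2 (hasSum_toReal p).summable).mul_left B
      have h2 : Summable fun x => b x * (p (y - x)).toReal :=
        Summable.of_norm_bounded h1 fun x => by
          rw [Real.norm_eq_abs, abs_mul, abs_of_nonneg ENNReal.toReal_nonneg]
          exact mul_le_mul_of_nonneg_right (hb x) ENNReal.toReal_nonneg
      simpa [Function.comp_def] using h2.hasSum
  refine (hasSum_sum h).congr_fun ?_
  intro q
  simp

lemma jumpRate_nonneg (g : RateFunction) {c : ℝ} (hc : 0 ≤ c) (α : Environment c)
    (ζ : Config) (x : ℤ) :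
    0 ≤ α.val x * g.ext (ζ x) :=
  mul_nonneg (hc.trans (α.mem_Ioc x).1.le) (g.ext_nonneg _)

lemma jumpRate_le_one (g : RateFunction) {c : ℝ} (α : Environment c) (ζ : Config) (x : ℤ) :
    α.val x * g.ext (ζ x) ≤ 1 :=
  (mul_le_of_le_one_left (g.ext_nonneg _) (α.mem_Ioc x).2).trans (g.ext_le_one _)

lemma abs_jumpRate_le_one (g : RateFunction) {c : ℝ} (hc : 0 ≤ c) (α : Environment c)
    (ζ : Config) (x : ℤ) :
    |α.val x * g.ext (ζ x)| ≤ 1 := by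
  rw [abs_of_nonneg (jumpRate_nonneg g hc α ζ x)]
  exact jumpRate_le_one g α ζ x

section

variable (g : RateFunction) {c : ℝ} (α : Environment c) (p : PMF ℤ) (A : Finset ℤ) (K : ℕ)

/-- A dominating family for the series defining the generator on `boxCount A K`. -/
lemma hasSum_dominating :
    HasSum (fun q : ℤ × ℤ => (if q.1 ∈ A then (p (q.2 - q.1)).toReal else 0) +
      (if q.2 ∈ A then (p (q.2 - q.1)).toReal else 0)) (2 * A.card) := by
  have h1 := hasSum_row p A fun _ => 1
  have h2 := hasSum_col p A (fun _ => 1) (B := 1) (by simp)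
  have h3 : ∀ y : ℤ, ∑' x, (p (y - x)).toReal = 1 := fun y =>
    ((Equiv.subLeft y).hasSum_iff.2 (hasSum_toReal p)).tsum_eq
  have := h1.add h2
  simp only [one_mul, h3, Finset.sum_const, nsmul_eq_mul, mul_one, ← two_mul] at this
  exact this

lemma abs_generator_term_le (hc : 0 ≤ c) (ζ : Config) (q : ℤ × ℤ) :
    |α.val q.1 * (p (q.2 - q.1)).toReal * g.ext (ζ q.1) *
      (boxCount A K (jump ζ q.1 q.2) - boxCount A K ζ)| ≤
      (if q.1 ∈ A then (p (q.2 - q.1)).toReal else 0) +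
      (if q.2 ∈ A then (p (q.2 - q.1)).toReal else 0) := by
  have h1 := abs_boxCount_jump_sub_le A K ζ q.1 q.2
  have h2 := jumpRate_nonneg g hc α ζ q.1
  have h3 := jumpRate_le_one g α ζ q.1
  have h4 : 0 ≤ (p (q.2 - q.1)).toReal := ENNReal.toReal_nonneg
  rw [mul_right_comm (α.val q.1), abs_mul, abs_mul, abs_of_nonneg h2, abs_of_nonneg h4]
  calc _ ≤ 1 * (p (q.2 - q.1)).toReal *
          ((if q.1 ∈ A then 1 else 0) + (if q.2 ∈ A then 1 else 0)) := by
        gcongr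
    _ = _ := by split_ifs <;> ring

lemma summable_generator (hc : 0 ≤ c) (ζ : Config) :
    Summable fun q : ℤ × ℤ => α.val q.1 * (p (q.2 - q.1)).toReal * g.ext (ζ q.1) *
      (boxCount A K (jump ζ q.1 q.2) - boxCount A K ζ) :=
  Summable.of_norm_bounded (hasSum_dominating p A).summable
    fun q => abs_generator_term_le g α p A K hc ζ q

lemma abs_generator_boxCount_le (hc : 0 ≤ c) (ζ : Config) :
    |generator g α p (boxCount A K) ζ| ≤ 2 * A.card :=
  tsum_of_norm_bounded
    (f := fun q : ℤ × ℤ => α.val q.1 * (p (q.2 - q.1)).toReal * g.ext (ζ q.1) *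
      (boxCount A K (jump ζ q.1 q.2) - boxCount A K ζ)) (hasSum_dominating p A)
    fun q => abs_generator_term_le g α p A K hc ζ q

lemma measurable_ext_apply (x : ℤ) : Measurable fun ζ : Config => g.ext (ζ x) :=
  (Measurable.of_discrete (f := g.ext)).comp (measurable_pi_apply x)

lemma measurable_generator_boxCount (hc : 0 ≤ c) :
    Measurable (generator g α p (boxCount A K)) := by
  refine measurable_of_tendsto_metrizable' (atTop : Filter (Finset (ℤ × ℤ)))
    (f := fun s ζ => ∑ q ∈ s, α.val q.1 * (p (q.2 - q.1)).toReal * g.ext (ζ q.1) *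
      (boxCount A K (jump ζ q.1 q.2) - boxCount A K ζ)) (fun s => ?_) ?_
  · refine Finset.measurable_sum _ fun q _ => ?_
    refine ((measurable_ext_apply g q.1).const_mul _).mul ?_
    exact ((measurable_boxCount A K).comp (measurable_jump _ _)).sub (measurable_boxCount A K)
  · exact tendsto_pi_nhds.2 fun ζ => (summable_generator g α p A K hc ζ).hasSum

/-- The rate at which particles enter `A`, counting the jumps inside `A`, plus the error due to
the truncation. -/
def inflow (ζ : Config) : ℝ :=
  ∑ y ∈ A, ∑' x, α.val x * g.ext (ζ x) * (p (y - x)).toReal +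
    ∑ x ∈ A, if ζ x ≤ K then 0 else 1

/-- The rate at which particles leave the sites of `A`, counting the jumps inside `A`. -/
def outflow (ζ : Config) : ℝ := ∑ x ∈ A, α.val x * g.ext (ζ x)

/-- Conservation of the number of particles: up to truncation, it grows at most at rate
`inflow - outflow`. -/
lemma generator_boxCount_add_outflow_le (hc : 0 ≤ c) (hp : p 0 = 0) (ζ : Config) :
    generator g α p (boxCount A K) ζ + outflow g α A ζ ≤ inflow g α p A K ζ := by
  have h1 := hasSum_col p A (fun x => α.val x * g.ext (ζ x)) (abs_jumpRate_le_one g hc α ζ)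
  have h2 := hasSum_row p A fun x => if ζ x ≤ (K : ℕ∞) then (0 : ℝ) else 1
  have h3 := hasSum_row p A fun x => α.val x * g.ext (ζ x)
  have h4 := (summable_generator g α p A K hc ζ).hasSum
  refine hasSum_le (fun q => ?_) (h4.add h3) (h1.add h2)
  have hr := jumpRate_nonneg g hc α ζ q.1
  have hr1 := jumpRate_le_one g α ζ q.1
  have hP : 0 ≤ (p (q.2 - q.1)).toReal := ENNReal.toReal_nonneg
  by_cases hxy : q.1 = q.2
  · simp [hxy, hp]
  by_cases hx : ζ q.1 = 0
  · simp [hx, g.ext_zero]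
  have hj := mul_le_mul_of_nonneg_left (boxCount_jump_sub_le A K hxy hx) (mul_nonneg hr hP)
  have hP1 : α.val q.1 * g.ext (ζ q.1) * (p (q.2 - q.1)).toReal ≤ (p (q.2 - q.1)).toReal :=
    mul_le_of_le_one_left hP hr1
  rw [mul_right_comm (α.val q.1)]
  revert hj
  split_ifs <;> intro hj <;> linarith

lemma outflow_nonneg (hc : 0 ≤ c) (ζ : Config) : 0 ≤ outflow g α A ζ :=
  Finset.sum_nonneg fun x _ => jumpRate_nonneg g hc α ζ x

lemma outflow_le (ζ : Config) : outflow g α A ζ ≤ A.card := by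
  have := Finset.sum_le_card_nsmul A (fun x => α.val x * g.ext (ζ x)) 1
    fun x _ => jumpRate_le_one g α ζ x
  simpa [outflow] using this

lemma measurable_outflow : Measurable (outflow g α A) :=
  Finset.measurable_sum _ fun x _ => (measurable_ext_apply g x).const_mul _

lemma ofReal_tsum_inflow (hc : 0 ≤ c) (y : ℤ) (ζ : Config) :
    ENNReal.ofReal (∑' x, α.val x * g.ext (ζ x) * (p (y - x)).toReal) =
      ∑' x, ENNReal.ofReal (α.val x) * p (y - x) * ENNReal.ofReal (g.ext (ζ x)) := by
  have hs : Summable fun x => α.val x * g.ext (ζ x) * (p (y - x)).toReal :=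
    Summable.of_norm_bounded
      ((Equiv.subLeft y).summable_iff.2 (hasSum_toReal p).summable) fun x => by
        rw [Real.norm_eq_abs, abs_mul, abs_of_nonneg (ENNReal.toReal_nonneg (a := p (y - x)))]
        exact mul_le_of_le_one_left ENNReal.toReal_nonneg (abs_jumpRate_le_one g hc α ζ x)
  rw [ENNReal.ofReal_tsum_of_nonneg
    (fun x => mul_nonneg (jumpRate_nonneg g hc α ζ x) ENNReal.toReal_nonneg) hs]
  refine tsum_congr fun x => ?_
  rw [ENNReal.ofReal_mul (jumpRate_nonneg g hc α ζ x),
    ENNReal.ofReal_mul (hc.trans (α.mem_Ioc x).1.le), ENNReal.ofReal_toReal (p.apply_ne_top _),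
    mul_right_comm]

lemma tsum_inflow_nonneg (hc : 0 ≤ c) (y : ℤ) (ζ : Config) :
    0 ≤ ∑' x, α.val x * g.ext (ζ x) * (p (y - x)).toReal :=
  tsum_nonneg fun x => mul_nonneg (jumpRate_nonneg g hc α ζ x) ENNReal.toReal_nonneg

lemma ofReal_inflow (hc : 0 ≤ c) (ζ : Config) :
    ENNReal.ofReal (inflow g α p A K ζ) =
      ∑ y ∈ A, ∑' x, ENNReal.ofReal (α.val x) * p (y - x) * ENNReal.ofReal (g.ext (ζ x)) +
        ∑ x ∈ A, if ζ x ≤ K then 0 else 1 := by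
  rw [inflow, ENNReal.ofReal_add (Finset.sum_nonneg fun y _ => tsum_inflow_nonneg g α p hc y ζ)
    (Finset.sum_nonneg fun x _ => by split_ifs <;> norm_num),
    ENNReal.ofReal_sum_of_nonneg (fun y _ => tsum_inflow_nonneg g α p hc y ζ),
    ENNReal.ofReal_sum_of_nonneg (fun x _ => by split_ifs <;> norm_num)]
  congr 1
  · exact Finset.sum_congr rfl fun y _ => ofReal_tsum_inflow g α p hc y ζ
  · exact Finset.sum_congr rfl fun x _ => by split_ifs <;> simp

lemma inflow_nonneg (hc : 0 ≤ c) (ζ : Config) : 0 ≤ inflow g α p A K ζ :=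
  add_nonneg (Finset.sum_nonneg fun y _ => tsum_inflow_nonneg g α p hc y ζ)
    (Finset.sum_nonneg fun x _ => by split_ifs <;> norm_num)

lemma tsum_sub_left_eq_one (y : ℤ) : ∑' x, p (y - x) = 1 :=
  ((Equiv.subLeft y).tsum_eq p).trans p.tsum_coe

lemma ofReal_inflow_le (hc : 0 ≤ c) (ζ : Config) :
    ENNReal.ofReal (inflow g α p A K ζ) ≤ 2 * A.card := by
  rw [ofReal_inflow g α p A K hc, two_mul]
  refine add_le_add ?_ ?_
  · refine (Finset.sum_le_card_nsmul A _ 1 fun y _ => ?_).trans (by simp)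
    rw [← tsum_sub_left_eq_one p y]
    refine ENNReal.tsum_le_tsum fun x => ?_
    rw [mul_right_comm, ← ENNReal.ofReal_mul (hc.trans (α.mem_Ioc x).1.le)]
    exact mul_le_of_le_one_left zero_le
      (ENNReal.ofReal_le_one.2 (jumpRate_le_one g α ζ x))
  · refine (Finset.sum_le_card_nsmul A _ 1 fun y _ => ?_).trans (by simp)
    split_ifs <;> simp

lemma inflow_le (hc : 0 ≤ c) (ζ : Config) : inflow g α p A K ζ ≤ 2 * A.card := by
  have h := ofReal_inflow_le g α p A K hc ζ
  rw [← ENNReal.toReal_ofReal (inflow_nonneg g α p A K hc ζ)]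
  refine (ENNReal.toReal_mono ?_ h).trans (by simp)
  exact ENNReal.mul_ne_top (by simp) (by simp)

lemma measurable_inflow (hc : 0 ≤ c) : Measurable (inflow g α p A K) := by
  have h : Measurable fun ζ => ENNReal.ofReal (inflow g α p A K ζ) := by
    simp_rw [ofReal_inflow g α p A K hc]
    refine (Finset.measurable_sum _ fun y _ => Measurable.tsum fun x =>
      ((measurable_ext_apply g x).ennreal_ofReal.const_mul _)).add ?_
    exact Finset.measurable_sum _ fun x _ => (Measurable.of_discrete
      (f := fun k : ℕ∞ => if k ≤ K then (0 : ℝ≥0∞) else 1)).comp (measurable_pi_apply x)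
  refine (congrArg Measurable (funext fun ζ => ?_)).mp h.ennreal_toReal
  exact ENNReal.toReal_ofReal (inflow_nonneg g α p A K hc ζ)

end

/-! ### Mean evolution of truncated particle numbers -/

section

variable {Ω : Type*} [mΩ : MeasurableSpace Ω] {P : Measure Ω} {η : ℝ≥0 → Ω → Config}
  {g : RateFunction} {c : ℝ} {α : Environment c} {p : PMF ℤ} {η₀ : Config}

lemma IsZeroRangeProcess.measurable_apply (h : IsZeroRangeProcess g α p η₀ P η) (t : ℝ≥0) :
    Measurable (η t) := by
  obtain ⟨ℱ, hℱ, -⟩ := h.martingale_problem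
  exact (hℱ t).mono (ℱ.le t) le_rfl

lemma IsZeroRangeProcess.measurable_path (h : IsZeroRangeProcess g α p η₀ P η) :
    Measurable fun q : ℝ≥0 × Ω => η q.1 q.2 :=
  measurable_uncurry_of_rightContinuous h.measurable_apply h.right_continuous

variable [IsProbabilityMeasure P]

lemma integrable_comp_path (hη : Measurable fun q : ℝ≥0 × Ω => η q.1 q.2) {v : Config → ℝ}
    (hv : Measurable v) {C : ℝ} (hC : ∀ ζ, |v ζ| ≤ C) (t : ℝ) :
    Integrable (fun q : ℝ × Ω => v (η q.1.toNNReal q.2))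
      ((volume.restrict (Set.Ioc 0 t)).prod P) :=
  Integrable.of_bound (hv.comp (hη.comp
    (measurable_real_toNNReal.prodMap measurable_id))).aestronglyMeasurable C
    (Eventually.of_forall fun _ => hC _)

lemma intervalIntegrable_comp_path (hη : Measurable fun q : ℝ≥0 × Ω => η q.1 q.2)
    {v : Config → ℝ} (hv : Measurable v) {C : ℝ} (hC : ∀ ζ, |v ζ| ≤ C) (ω : Ω) {t : ℝ}
    (ht : 0 ≤ t) : IntervalIntegrable (fun s : ℝ => v (η s.toNNReal ω)) volume 0 t := by
  rw [intervalIntegrable_iff_integrableOn_Ioc_of_le ht]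
  refine Integrable.of_bound (Measurable.aestronglyMeasurable ?_) C
    (Eventually.of_forall fun _ => hC _)
  exact hv.comp (hη.comp (measurable_real_toNNReal.prodMk measurable_const))

lemma integrable_intervalIntegral_comp_path (hη : Measurable fun q : ℝ≥0 × Ω => η q.1 q.2)
    {v : Config → ℝ} (hv : Measurable v) {C : ℝ} (hC : ∀ ζ, |v ζ| ≤ C) {t : ℝ} (ht : 0 ≤ t) :
    Integrable (fun ω => ∫ s in (0 : ℝ)..t, v (η s.toNNReal ω)) P := by
  simp_rw [intervalIntegral.integral_of_le ht]
  exact (integrable_comp_path hη hv hC t).integral_prod_right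

lemma ofReal_integral_intervalIntegral (hη : Measurable fun q : ℝ≥0 × Ω => η q.1 q.2)
    {v : Config → ℝ} (hv : Measurable v) (h0 : ∀ ζ, 0 ≤ v ζ) {C : ℝ} (hC : ∀ ζ, v ζ ≤ C)
    {t : ℝ} (ht : 0 ≤ t) :
    ENNReal.ofReal (∫ ω, (∫ s in (0 : ℝ)..t, v (η s.toNNReal ω)) ∂P) =
      ∫⁻ s in Set.Ioc 0 t, ∫⁻ ω, ENNReal.ofReal (v (η s.toNNReal ω)) ∂P := by
  have hi := integrable_comp_path (P := P) hη hv
    (fun ζ => (abs_of_nonneg (h0 ζ)).trans_le (hC ζ)) t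
  simp_rw [intervalIntegral.integral_of_le ht]
  rw [← integral_prod_symm _ hi, ofReal_integral_eq_lintegral_ofReal hi
    (Eventually.of_forall fun q => h0 _), lintegral_prod _ hi.1.aemeasurable.ennreal_ofReal]

/-- The mean rate `E g(η_s(x))` at which site `x` is served at time `s`, up to the factor
`α(x)`. The time is a real number, as in the integrals, and negative times are read as `0`. -/
def meanRate (g : RateFunction) (P : Measure Ω) (η : ℝ≥0 → Ω → Config) (s : ℝ) (x : ℤ) : ℝ≥0∞ :=
  ∫⁻ ω, ENNReal.ofReal (g.ext (η s.toNNReal ω x)) ∂P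

lemma meanRate_le_one (g : RateFunction) (s : ℝ) (x : ℤ) : meanRate g P η s x ≤ 1 :=
  (lintegral_mono fun ω => ENNReal.ofReal_le_one.2 (g.ext_le_one (η s.toNNReal ω x))).trans
    (by simp)

lemma measurable_meanRate (g : RateFunction) (hη : Measurable fun q : ℝ≥0 × Ω => η q.1 q.2)
    (x : ℤ) : Measurable fun s => meanRate g P η s x :=
  Measurable.lintegral_prod_right'
    (f := fun q : ℝ × Ω => ENNReal.ofReal (g.ext (η q.1.toNNReal q.2 x)))
    (((measurable_ext_apply g x).comp (hη.comp
      (measurable_real_toNNReal.prodMap measurable_id))).ennreal_ofReal)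

/-- Dynkin's formula for truncated particle numbers. -/
lemma IsZeroRangeProcess.integral_boxCount (h : IsZeroRangeProcess g α p η₀ P η) (hc : 0 ≤ c)
    (A : Finset ℤ) (K : ℕ) {t : ℝ} (ht : 0 ≤ t) :
    ∫ ω, boxCount A K (η t.toNNReal ω) ∂P = boxCount A K η₀ +
      ∫ ω, (∫ s in (0 : ℝ)..t, generator g α p (boxCount A K) (η s.toNNReal ω)) ∂P := by
  obtain ⟨ℱ, -, hM⟩ := h.martingale_problem
  have hb : ∀ ζ, |boxCount A K ζ| ≤ A.card * K := fun ζ =>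
    (abs_of_nonneg (boxCount_nonneg A K ζ)).trans_le (boxCount_le A K ζ)
  have hM := hM (boxCount A K) (isCylinder_boxCount A K) ⟨_, hb⟩
  have h1 := hM.setIntegral_eq (zero_le (a := t.toNNReal)) MeasurableSet.univ
  have hint : ∀ s, Integrable (fun ω => boxCount A K (η s ω)) P := fun s =>
    Integrable.of_bound ((measurable_boxCount A K).comp
      (h.measurable_apply s)).aestronglyMeasurable _ (Eventually.of_forall fun ω => hb _)
  have hint2 := integrable_intervalIntegral_comp_path (P := P) h.measurable_path
    (measurable_generator_boxCount g α p A K hc) (abs_generator_boxCount_le g α p A K hc) ht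
  have h0 : ∫ ω, boxCount A K (η 0 ω) ∂P = boxCount A K η₀ := by
    rw [integral_congr_ae (h.initial.mono fun ω hω => by rw [hω])]
    simp
  simp only [Measure.restrict_univ, sub_self, NNReal.coe_zero, intervalIntegral.integral_same,
    integral_zero, Real.coe_toNNReal t ht] at h1
  have h2 := integral_sub ((hint t.toNNReal).sub (hint 0)) hint2
  simp only [Pi.sub_apply] at h2
  rw [h2, integral_sub (hint _) (hint _), h0] at h1
  linarith

/-- The mean balance of particles in `A`: those present at time `t` plus those which have left are
at most those present initially plus those which have entered, up to an error due to the
truncation. -/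
lemma IsZeroRangeProcess.boxCount_add_outflow_le (h : IsZeroRangeProcess g α p η₀ P η)
    (hc : 0 ≤ c) (hp : p 0 = 0) (A : Finset ℤ) (K : ℕ) {t : ℝ} (ht : 0 ≤ t) :
    ∫⁻ ω, ENNReal.ofReal (boxCount A K (η t.toNNReal ω)) ∂P +
        ∫⁻ s in Set.Ioc 0 t, ∑ x ∈ A, ENNReal.ofReal (α.val x) * meanRate g P η s x ≤
      ENNReal.ofReal (boxCount A K η₀) + ∫⁻ s in Set.Ioc 0 t,
        (∑ y ∈ A, ∑' x, ENNReal.ofReal (α.val x) * p (y - x) * meanRate g P η s x +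
          ∑ x ∈ A, P {ω | (K : ℕ∞) < η s.toNNReal ω x}) := by
  have hη := h.measurable_path
  have hb : ∀ ζ, |boxCount A K ζ| ≤ A.card * K := fun ζ =>
    (abs_of_nonneg (boxCount_nonneg A K ζ)).trans_le (boxCount_le A K ζ)
  have hint : Integrable (fun ω => boxCount A K (η t.toNNReal ω)) P :=
    Integrable.of_bound ((measurable_boxCount A K).comp
      (h.measurable_apply _)).aestronglyMeasurable _ (Eventually.of_forall fun ω => hb _)
  have hout : ∀ ζ, |outflow g α A ζ| ≤ A.card := fun ζ =>
    (abs_of_nonneg (outflow_nonneg g α A hc ζ)).trans_le (outflow_le g α A ζ)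
  have hin : ∀ ζ, |inflow g α p A K ζ| ≤ 2 * A.card := fun ζ =>
    (abs_of_nonneg (inflow_nonneg g α p A K hc ζ)).trans_le (inflow_le g α p A K hc ζ)
  have hmo := measurable_outflow g α A
  have hmi := measurable_inflow g α p A K hc
  have hmg := measurable_generator_boxCount g α p A K hc
  have hbg := abs_generator_boxCount_le g α p A K hc
  have io := integrable_intervalIntegral_comp_path (P := P) hη hmo hout ht
  have ii := integrable_intervalIntegral_comp_path (P := P) hη hmi hin ht
  have ig := integrable_intervalIntegral_comp_path (P := P) hη hmg hbg ht
  have key : ∫ ω, boxCount A K (η t.toNNReal ω) ∂P +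
      ∫ ω, (∫ s in (0 : ℝ)..t, outflow g α A (η s.toNNReal ω)) ∂P ≤
      boxCount A K η₀ + ∫ ω, (∫ s in (0 : ℝ)..t, inflow g α p A K (η s.toNNReal ω)) ∂P := by
    rw [h.integral_boxCount hc A K ht, add_assoc, ← integral_add ig io]
    refine add_le_add_right (integral_mono (ig.add io) ii fun ω => ?_) _
    have jo := intervalIntegrable_comp_path hη hmo hout ω ht
    have ji := intervalIntegrable_comp_path hη hmi hin ω ht
    have jg := intervalIntegrable_comp_path hη hmg hbg ω ht
    simp only [Pi.add_apply]
    rw [← intervalIntegral.integral_add jg jo]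
    exact intervalIntegral.integral_mono_on ht (jg.add jo) ji
      fun s _ => generator_boxCount_add_outflow_le g α p A K hc hp _
  have hmeas : ∀ s : ℝ, Measurable (η s.toNNReal) := fun s => h.measurable_apply _
  have e1 : ∀ s : ℝ, ∫⁻ ω, ENNReal.ofReal (outflow g α A (η s.toNNReal ω)) ∂P =
      ∑ x ∈ A, ENNReal.ofReal (α.val x) * meanRate g P η s x := by
    intro s
    have : ∀ ζ : Config, ENNReal.ofReal (outflow g α A ζ) =
        ∑ x ∈ A, ENNReal.ofReal (α.val x) * ENNReal.ofReal (g.ext (ζ x)) := fun ζ => by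
      rw [outflow, ENNReal.ofReal_sum_of_nonneg fun x _ => jumpRate_nonneg g hc α ζ x]
      exact Finset.sum_congr rfl fun x _ => ENNReal.ofReal_mul (hc.trans (α.mem_Ioc x).1.le)
    simp_rw [this]
    have hm : ∀ x, Measurable fun ω => ENNReal.ofReal (g.ext (η s.toNNReal ω x)) := fun x =>
      ((measurable_ext_apply g x).comp (hmeas s)).ennreal_ofReal
    rw [lintegral_finsetSum _ fun x _ => (hm x).const_mul _]
    exact Finset.sum_congr rfl fun x _ => lintegral_const_mul _ (hm x)
  have e2 : ∀ s : ℝ, ∫⁻ ω, ENNReal.ofReal (inflow g α p A K (η s.toNNReal ω)) ∂P =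
      ∑ y ∈ A, ∑' x, ENNReal.ofReal (α.val x) * p (y - x) * meanRate g P η s x +
        ∑ x ∈ A, P {ω | (K : ℕ∞) < η s.toNNReal ω x} := by
    intro s
    simp_rw [ofReal_inflow g α p A K hc]
    have hm : ∀ x, Measurable fun ω => ENNReal.ofReal (g.ext (η s.toNNReal ω x)) := fun x =>
      ((measurable_ext_apply g x).comp (hmeas s)).ennreal_ofReal
    rw [lintegral_add_left (Finset.measurable_sum _ fun y _ => Measurable.tsum fun x =>
      (hm x).const_mul _), lintegral_finsetSum _ fun y _ => Measurable.tsum fun x =>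
      (hm x).const_mul _, lintegral_finsetSum]
    · congr 1
      · refine Finset.sum_congr rfl fun y _ => ?_
        rw [lintegral_tsum fun x => ((hm x).const_mul _).aemeasurable]
        exact tsum_congr fun x => lintegral_const_mul _ (hm x)
      · refine Finset.sum_congr rfl fun x _ => ?_
        have hset : MeasurableSet {ω | (K : ℕ∞) < η s.toNNReal ω x} :=
          ((measurable_pi_apply x).comp (hmeas s))
            (MeasurableSet.of_discrete (s := Set.Ioi (K : ℕ∞)))
        rw [← lintegral_indicator_one hset]
        refine lintegral_congr fun ω => ?_
        by_cases hK : (K : ℕ∞) < η s.toNNReal ω x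
        · simp [hK]
        · simp [hK, not_lt.1 hK]
    · intro x _
      exact (Measurable.of_discrete (f := fun k : ℕ∞ => if k ≤ K then (0 : ℝ≥0∞) else 1)).comp
        ((measurable_pi_apply x).comp (hmeas s))
  rw [lintegral_congr fun s => (e1 s).symm, lintegral_congr fun s => (e2 s).symm,
    ← ofReal_integral_intervalIntegral hη hmo (outflow_nonneg g α A hc) (outflow_le g α A) ht,
    ← ofReal_integral_intervalIntegral hη hmi (inflow_nonneg g α p A K hc)
      (inflow_le g α p A K hc) ht,
    ← ofReal_integral_eq_lintegral_ofReal hint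
      (Eventually.of_forall fun ω => boxCount_nonneg A K _),
    ← ENNReal.ofReal_add (integral_nonneg fun ω => boxCount_nonneg A K _)
      (integral_nonneg fun ω => intervalIntegral.integral_nonneg ht fun s _ =>
        outflow_nonneg g α A hc _),
    ← ENNReal.ofReal_add (boxCount_nonneg A K _)
      (integral_nonneg fun ω => intervalIntegral.integral_nonneg ht fun s _ =>
        inflow_nonneg g α p A K hc _)]
  exact ENNReal.ofReal_le_ofReal key

end

/-! ### A priori bounds on the number of particles at a site -/

section

variable {Ω : Type*} [mΩ : MeasurableSpace Ω] {P : Measure Ω} [IsProbabilityMeasure P]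
  {η : ℝ≥0 → Ω → Config} {g : RateFunction} {c : ℝ} {α : Environment c} {p : PMF ℤ}
  {η₀ : ℤ → ℕ}

lemma ofReal_boxCount_natCast_le (A : Finset ℤ) (K : ℕ) (η₀ : ℤ → ℕ) :
    ENNReal.ofReal (boxCount A K fun x => (η₀ x : ℕ∞)) ≤ ∑ x ∈ A, (η₀ x : ℝ≥0∞) := by
  rw [boxCount, ENNReal.ofReal_sum_of_nonneg fun x _ => Nat.cast_nonneg _]
  refine Finset.sum_le_sum fun x _ => ?_
  rw [ENNReal.ofReal_natCast, cap_natCast]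
  exact_mod_cast min_le_left _ _

/-- The balance at a single site, without the outflow. The last probability is the truncation
error. -/
lemma IsZeroRangeProcess.lintegral_cap_le
    (h : IsZeroRangeProcess g α p (fun x => (η₀ x : ℕ∞)) P η) (hc : 0 ≤ c) (hp : p 0 = 0)
    (y : ℤ) (K : ℕ) {t : ℝ} (ht : 0 ≤ t) :
    ∫⁻ ω, (cap K (η t.toNNReal ω y) : ℝ≥0∞) ∂P ≤ η₀ y + ∫⁻ s in Set.Ioc 0 t,
        (∑' x, p (y - x) * meanRate g P η s x + P {ω | (K : ℕ∞) < η s.toNNReal ω y}) := by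
  have h1 := (le_self_add).trans (h.boxCount_add_outflow_le hc hp {y} K ht)
  simp only [boxCount, Finset.sum_singleton, ENNReal.ofReal_natCast] at h1
  refine h1.trans (add_le_add ?_ (lintegral_mono fun s => ?_))
  · rw [cap_natCast]
    exact_mod_cast min_le_left _ _
  · refine add_le_add (ENNReal.tsum_le_tsum fun x => ?_) le_rfl
    refine mul_le_mul_left ?_ _
    exact mul_le_of_le_one_left zero_le (ENNReal.ofReal_le_one.2 (α.mem_Ioc x).2)

lemma tsum_mul_meanRate_le_one (p : PMF ℤ) (g : RateFunction) (s : ℝ) (y : ℤ) :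
    ∑' x, p (y - x) * meanRate g P η s x ≤ 1 := by
  rw [← tsum_sub_left_eq_one p y]
  exact ENNReal.tsum_le_tsum fun x => mul_le_of_le_one_right zero_le (meanRate_le_one g s x)

/-- At a fixed time, infinitely many particles at a site are excluded, with a Markov bound. -/
lemma IsZeroRangeProcess.mul_measure_lt_le
    (h : IsZeroRangeProcess g α p (fun x => (η₀ x : ℕ∞)) P η) (hc : 0 ≤ c) (hp : p 0 = 0)
    (y : ℤ) (K : ℕ) {t : ℝ} (ht : 0 ≤ t) :
    K * P {ω | (K : ℕ∞) < η t.toNNReal ω y} ≤ η₀ y + 2 * ENNReal.ofReal t := by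
  have hset : MeasurableSet {ω | (K : ℕ∞) < η t.toNNReal ω y} :=
    ((measurable_pi_apply y).comp (h.measurable_apply _))
      (MeasurableSet.of_discrete (s := Set.Ioi (K : ℕ∞)))
  calc K * P {ω | (K : ℕ∞) < η t.toNNReal ω y}
      = ∫⁻ ω, {ω | (K : ℕ∞) < η t.toNNReal ω y}.indicator (fun _ => (K : ℝ≥0∞)) ω ∂P := by
        rw [lintegral_indicator_const hset]
    _ ≤ ∫⁻ ω, (cap K (η t.toNNReal ω y) : ℝ≥0∞) ∂P := by
        refine lintegral_mono fun ω => ?_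
        refine Set.indicator_apply_le' (fun hω => ?_) fun _ => zero_le
        have : cap K (η t.toNNReal ω y) = K := by
          rw [cap, min_eq_right (le_of_lt hω), ENat.toNat_natCast]
        rw [this]
    _ ≤ _ := h.lintegral_cap_le hc hp y K ht
    -- the truncation error itself is estimated by one at this point
    _ ≤ η₀ y + ∫⁻ _ in Set.Ioc 0 t, 2 := by
        gcongr with s
        rw [← one_add_one_eq_two]
        exact add_le_add (tsum_mul_meanRate_le_one p g s y) prob_le_one
    _ = _ := by simp

/-- Mass is transported by the jumps only: the mean rate at a site is at most the initial number
of particles plus the number of those which have jumped there. -/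
lemma IsZeroRangeProcess.meanRate_le
    (h : IsZeroRangeProcess g α p (fun x => (η₀ x : ℕ∞)) P η) (hc : 0 ≤ c) (hp : p 0 = 0)
    (y : ℤ) {t : ℝ} (ht : 0 ≤ t) :
    meanRate g P η t y ≤ η₀ y + ∫⁻ s in Set.Ioc 0 t, ∑' x, p (y - x) * meanRate g P η s x := by
  have hbd : ∀ K : ℕ, meanRate g P η t y ≤
      η₀ y + (∫⁻ s in Set.Ioc 0 t, ∑' x, p (y - x) * meanRate g P η s x) +
        (η₀ y + 2 * ENNReal.ofReal t) * ENNReal.ofReal t / (K + 1 : ℕ) := by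
    intro K
    have hK0 : ((K + 1 : ℕ) : ℝ≥0∞) ≠ 0 := by exact_mod_cast K.succ_ne_zero
    have hKt : ((K + 1 : ℕ) : ℝ≥0∞) ≠ ⊤ := ENNReal.natCast_ne_top _
    calc meanRate g P η t y ≤ ∫⁻ ω, (cap (K + 1) (η t.toNNReal ω y) : ℝ≥0∞) ∂P := by
          refine lintegral_mono fun ω => ?_
          by_cases h0 : η t.toNNReal ω y = 0
          · simp [h0, g.ext_zero]
          · have h1 : 1 ≤ cap (K + 1) (η t.toNNReal ω y) := by
              generalize η t.toNNReal ω y = k at h0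
              induction k using ENat.recTopCoe with
              | top => simp [cap_top]
              | coe k =>
                have : k ≠ 0 := by exact_mod_cast h0
                rw [cap_natCast]; omega
            calc ENNReal.ofReal (g.ext (η t.toNNReal ω y)) ≤ 1 :=
                  ENNReal.ofReal_le_one.2 (g.ext_le_one _)
              _ ≤ _ := by exact_mod_cast h1
      _ ≤ _ := h.lintegral_cap_le hc hp y (K + 1) ht
      _ ≤ η₀ y + ∫⁻ s in Set.Ioc 0 t, (∑' x, p (y - x) * meanRate g P η s x +
            (η₀ y + 2 * ENNReal.ofReal t) / (K + 1 : ℕ)) := by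
          refine add_le_add_right (setLIntegral_mono' measurableSet_Ioc fun s hs => ?_) _
          refine add_le_add_right ?_ _
          rw [ENNReal.le_div_iff_mul_le (Or.inl hK0) (Or.inl hKt), mul_comm]
          refine (h.mul_measure_lt_le hc hp y (K + 1) hs.1.le).trans ?_
          gcongr
          exact hs.2
      _ = _ := by
          rw [lintegral_add_right _ measurable_const, ← add_assoc]
          simp [ENNReal.div_eq_inv_mul, mul_assoc]
  -- by the Markov bound, the truncation error vanishes as `K → ∞`
  refine ge_of_tendsto' (x := atTop) (f := fun K : ℕ =>
      η₀ y + (∫⁻ s in Set.Ioc 0 t, ∑' x, p (y - x) * meanRate g P η s x) +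
        (η₀ y + 2 * ENNReal.ofReal t) * ENNReal.ofReal t / (K + 1 : ℕ)) ?_ hbd
  have h0 : Tendsto (fun K : ℕ => (η₀ y + 2 * ENNReal.ofReal t) * ENNReal.ofReal t /
      (K + 1 : ℕ)) atTop (𝓝 0) := by
    have := ENNReal.Tendsto.const_mul (a := (η₀ y + 2 * ENNReal.ofReal t) * ENNReal.ofReal t)
      (ENNReal.tendsto_inv_nat_nhds_zero.comp (tendsto_add_atTop_nat 1)) (Or.inr (by finiteness))
    simpa [div_eq_mul_inv] using this
  simpa using h0.const_add
    (η₀ y + (∫⁻ s in Set.Ioc 0 t, ∑' x, p (y - x) * meanRate g P η s x))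

lemma lintegral_exp_le {t : ℝ} (ht : 0 ≤ t) :
    ∫⁻ s in Set.Ioc 0 t, ENNReal.ofReal (Real.exp (2 * s)) ≤
      ENNReal.ofReal (Real.exp (2 * t)) / 2 := by
  have hi : IntervalIntegrable (fun s : ℝ => Real.exp (2 * s)) volume 0 t :=
    (by fun_prop : Continuous fun s : ℝ => Real.exp (2 * s)).intervalIntegrable _ _
  rw [← ofReal_integral_eq_lintegral_ofReal
    ((intervalIntegrable_iff_integrableOn_Ioc_of_le ht).1 hi)
    (Eventually.of_forall fun s => (Real.exp_pos _).le),
    ← intervalIntegral.integral_of_le ht,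
    show (2 : ℝ≥0∞) = ENNReal.ofReal 2 by simp, ← ENNReal.ofReal_div_of_pos two_pos]
  refine ENNReal.ofReal_le_ofReal ?_
  have : ∫ s in (0 : ℝ)..t, Real.exp (2 * s) = (Real.exp (2 * t) - 1) / 2 := by
    rw [intervalIntegral.integral_comp_mul_left (fun s => Real.exp s) two_ne_zero]
    simp [integral_exp]
    ring
  rw [this]
  linarith

/-- Comparison principle: to the left of `b`, where nothing arrives from the right, the mean rates
are dominated by `exp (2 t) Ψ` as soon as `Ψ` is at least one on the support of the initial
configuration and satisfies `p * Ψ ≤ 2 Ψ`. -/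
lemma IsZeroRangeProcess.meanRate_le_exp_mul
    (h : IsZeroRangeProcess g α p (fun x => (η₀ x : ℕ∞)) P η) (hc : 0 ≤ c)
    (hp : ∀ z ≤ 0, p z = 0) {b : ℤ} {Ψ : ℤ → ℝ≥0∞} (hΨ : ∀ y < b, η₀ y ≠ 0 → 1 ≤ Ψ y)
    (hΨ2 : ∀ y, ∑' x, p (y - x) * Ψ x ≤ 2 * Ψ y) {y : ℤ} (hy : y < b) {t : ℝ} (ht : 0 ≤ t) :
    meanRate g P η t y ≤ ENNReal.ofReal (Real.exp (2 * t)) * Ψ y := by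
  have hone : ∀ {t : ℝ}, 0 ≤ t → 1 ≤ ENNReal.ofReal (Real.exp (2 * t)) := fun {t} ht =>
    ENNReal.one_le_ofReal.2 (Real.one_le_exp (by positivity))
  -- the excess over `exp (2 t) Ψ` is halved by each use of the integral inequality
  have key : ∀ n : ℕ, ∀ y < b, ∀ t : ℝ, 0 ≤ t →
      meanRate g P η t y ≤ ENNReal.ofReal (Real.exp (2 * t)) * (Ψ y + 2⁻¹ ^ n) := by
    intro n
    induction n with
    | zero =>
      intro y _ t ht
      refine (meanRate_le_one g t y).trans ?_
      calc (1 : ℝ≥0∞) ≤ ENNReal.ofReal (Real.exp (2 * t)) * 1 := by simpa using hone ht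
        _ ≤ _ := by gcongr; simp
    | succ n ih =>
      intro y hy t ht
      by_cases h0 : η₀ y = 0
      · refine (h.meanRate_le hc (hp 0 le_rfl) y ht).trans ?_
        rw [h0, Nat.cast_zero, zero_add]
        calc ∫⁻ s in Set.Ioc 0 t, ∑' x, p (y - x) * meanRate g P η s x
            ≤ ∫⁻ s in Set.Ioc 0 t, ENNReal.ofReal (Real.exp (2 * s)) * (2 * Ψ y + 2⁻¹ ^ n) := by
              refine setLIntegral_mono' measurableSet_Ioc fun s hs => ?_
              calc ∑' x, p (y - x) * meanRate g P η s x
                  ≤ ∑' x, ENNReal.ofReal (Real.exp (2 * s)) *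
                      (p (y - x) * Ψ x + p (y - x) * 2⁻¹ ^ n) := by
                    refine ENNReal.tsum_le_tsum fun x => ?_
                    rcases lt_or_ge x y with hxy | hxy
                    · calc _ ≤ p (y - x) * (ENNReal.ofReal (Real.exp (2 * s)) *
                            (Ψ x + 2⁻¹ ^ n)) := by
                            gcongr
                            exact ih x (hxy.trans hy) s hs.1.le
                        _ = _ := by ring
                    · simp [hp (y - x) (by omega)]
                _ ≤ _ := by
                    rw [ENNReal.tsum_mul_left, ENNReal.tsum_add, ENNReal.tsum_mul_right,
                      tsum_sub_left_eq_one, one_mul]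
                    gcongr
                    exact hΨ2 y
          _ = (∫⁻ s in Set.Ioc 0 t, ENNReal.ofReal (Real.exp (2 * s))) *
                (2 * Ψ y + 2⁻¹ ^ n) := lintegral_mul_const _ (by fun_prop)
          _ ≤ ENNReal.ofReal (Real.exp (2 * t)) / 2 * (2 * Ψ y + 2⁻¹ ^ n) := by
              gcongr
              exact lintegral_exp_le ht
          _ = _ := by
              rw [div_eq_mul_inv, mul_assoc, mul_add, ← mul_assoc 2⁻¹ 2,
                ENNReal.inv_mul_cancel two_ne_zero ENNReal.ofNat_ne_top, one_mul, pow_succ']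
      · refine (meanRate_le_one g t y).trans ?_
        calc (1 : ℝ≥0∞) = 1 * 1 := (one_mul 1).symm
          _ ≤ _ := mul_le_mul' (hone ht) ((hΨ y hy h0).trans le_self_add)
  refine ge_of_tendsto' (x := atTop) (f := fun n : ℕ =>
    ENNReal.ofReal (Real.exp (2 * t)) * (Ψ y + 2⁻¹ ^ n)) ?_ fun n => key n y hy t ht
  refine ENNReal.Tendsto.const_mul ?_ (Or.inr ENNReal.ofReal_ne_top)
  simpa using (ENNReal.tendsto_pow_atTop_nhds_zero_of_lt_one
    (ENNReal.inv_lt_one.2 ENNReal.one_lt_two)).const_add (Ψ y)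

end

/-! ### The Green function of the jump kernel -/

/-- The `n`-step transition function `y ↦ P(S_n = y)` of the random walk with kernel `p`. -/
def stepProb (p : PMF ℤ) : ℕ → ℤ → ℝ≥0∞
  | 0 => Pi.single 0 1
  | n + 1 => fun y => ∑' x, p (y - x) * stepProb p n x

/-- The Green function of the random walk with kernel `p`, killed with probability `1 / 2` at each
step. -/
def green (p : PMF ℤ) (y : ℤ) : ℝ≥0∞ := ∑' n, 2⁻¹ ^ n * stepProb p n y

lemma tsum_stepProb (p : PMF ℤ) (n : ℕ) : ∑' y, stepProb p n y = 1 := by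
  induction n with
  | zero => simp [stepProb]
  | succ n ih =>
    simp only [stepProb]
    rw [ENNReal.tsum_comm]
    have : ∀ x, ∑' y, p (y - x) * stepProb p n x = stepProb p n x := fun x => by
      rw [ENNReal.tsum_mul_right,
      show ∑' y, p (y - x) = 1 from ((Equiv.subRight x).tsum_eq p).trans p.tsum_coe, one_mul]
    simp_rw [this, ih]

lemma one_le_green_zero (p : PMF ℤ) : 1 ≤ green p 0 := by
  refine le_trans ?_ (ENNReal.le_tsum 0)
  simp [stepProb]

lemma tsum_mul_green_le (p : PMF ℤ) (y : ℤ) : ∑' x, p (y - x) * green p x ≤ 2 * green p y := by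
  have h2 : ∀ n : ℕ, (2⁻¹ : ℝ≥0∞) ^ n = 2 * 2⁻¹ ^ (n + 1) := fun n => by
    rw [pow_succ', ← mul_assoc, ENNReal.mul_inv_cancel two_ne_zero ENNReal.ofNat_ne_top, one_mul]
  calc ∑' x, p (y - x) * green p x
      = ∑' n : ℕ, 2 * (2⁻¹ ^ (n + 1) * stepProb p (n + 1) y) := by
        simp only [green, ← ENNReal.tsum_mul_left]
        rw [ENNReal.tsum_comm]
        refine tsum_congr fun n => ?_
        rw [← mul_assoc, ← h2, stepProb, ← ENNReal.tsum_mul_left]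
        exact tsum_congr fun x => by ring
    _ ≤ _ := by
        rw [ENNReal.tsum_mul_left, green]
        exact mul_le_mul' le_rfl (ENNReal.tsum_comp_le_tsum_of_injective (add_left_injective 1)
          fun n : ℕ => 2⁻¹ ^ n * stepProb p n y)

/-- Superpositions of translates of the Green function satisfy the inequality required by the
comparison principle. -/
lemma tsum_mul_tsum_green_le (p : PMF ℤ) (e : ℕ → ℤ) (y : ℤ) :
    ∑' x, p (y - x) * ∑' j, green p (x + e j) ≤ 2 * ∑' j, green p (y + e j) := by
  simp only [← ENNReal.tsum_mul_left]
  rw [ENNReal.tsum_comm]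
  refine ENNReal.tsum_le_tsum fun j => ?_
  refine le_trans (le_of_eq ?_) (tsum_mul_green_le p (y + e j))
  rw [← (Equiv.addRight (e j)).tsum_eq fun x => p (y + e j - x) * green p x]
  refine tsum_congr fun x => ?_
  simp

lemma tendsto_green (p : PMF ℤ) : Tendsto (green p) cofinite (𝓝 0) := by
  refine ENNReal.tendsto_cofinite_zero_of_tsum_ne_top ?_
  simp only [green]
  rw [ENNReal.tsum_comm]
  simp_rw [ENNReal.tsum_mul_left, tsum_stepProb, mul_one]
  rw [ENNReal.tsum_geometric]
  simp

/-! ### The flux through the origin -/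

section

variable {Ω : Type*} [mΩ : MeasurableSpace Ω] {P : Measure Ω} [IsProbabilityMeasure P]
  {η : ℝ≥0 → Ω → Config} {g : RateFunction} {c : ℝ} {α : Environment c} {p : PMF ℤ}
  {η₀ : ℤ → ℕ}

lemma sum_apply_sub_le_one (p : PMF ℤ) (A : Finset ℤ) (x : ℤ) : ∑ y ∈ A, p (y - x) ≤ 1 :=
  (ENNReal.sum_le_tsum A).trans (((Equiv.subRight x).tsum_eq p).trans p.tsum_coe).le

/-- Bound on the total inflow into `(b, 0]`, counting jumps inside this interval: outside it,
particles come only from `b`, at rate at most `α(b)`, or from the left of `b`, where the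
mean rates are controlled by `Ψ`. -/
lemma IsZeroRangeProcess.sum_inflow_le
    (h : IsZeroRangeProcess g α p (fun x => (η₀ x : ℕ∞)) P η) (hc : 0 ≤ c)
    (hp : ∀ z ≤ 0, p z = 0) {b : ℤ} {Ψ : ℤ → ℝ≥0∞} (hΨ : ∀ y < b, η₀ y ≠ 0 → 1 ≤ Ψ y)
    (hΨ2 : ∀ y, ∑' x, p (y - x) * Ψ x ≤ 2 * Ψ y) {s : ℝ} (hs : 0 ≤ s) :
    ∑ y ∈ Finset.Ioc b 0, ∑' x, ENNReal.ofReal (α.val x) * p (y - x) * meanRate g P η s x ≤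
      ∑ x ∈ Finset.Ioc b 0, ENNReal.ofReal (α.val x) * meanRate g P η s x *
        ∑ y ∈ Finset.Ioc b 0, p (y - x) +
      (ENNReal.ofReal (α.val b) +
        ENNReal.ofReal (Real.exp (2 * s)) * (2 * ∑ y ∈ Finset.Ioc b 0, Ψ y)) := by
  set w := meanRate g P η s
  set a : ℤ → ℝ≥0∞ := fun x => ENNReal.ofReal (α.val x)
  set A := Finset.Ioc b 0
  have ha : ∀ x, a x ≤ 1 := fun x => ENNReal.ofReal_le_one.2 (α.mem_Ioc x).2
  have hw : ∀ x, w x ≤ 1 := fun x => meanRate_le_one g s x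
  have hterm : ∀ y ∈ A, ∀ x, a x * p (y - x) * w x ≤
      (if x ∈ A then a x * w x * p (y - x) else 0) + ((if x = b then a b * p (y - b) else 0) +
        ENNReal.ofReal (Real.exp (2 * s)) * (p (y - x) * Ψ x)) := by
    intro y hy x
    have hyA := Finset.mem_Ioc.1 hy
    rcases lt_trichotomy x b with hx | hx | hx
    · refine le_add_left (le_add_left ?_)
      calc a x * p (y - x) * w x ≤ 1 * p (y - x) * (ENNReal.ofReal (Real.exp (2 * s)) * Ψ x) := by
            gcongr
            · exact ha x
            · exact h.meanRate_le_exp_mul hc hp hΨ hΨ2 hx hs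
        _ = _ := by ring
    · subst hx
      rw [if_pos rfl]
      exact le_add_left (le_add_right (mul_le_of_le_one_right zero_le (hw x)))
    · by_cases hxA : x ∈ A
      · rw [if_pos hxA]
        exact le_add_right (mul_right_comm _ _ _).le
      · have : 0 < x := by
          by_contra hx0
          exact hxA (Finset.mem_Ioc.2 ⟨hx, not_lt.1 hx0⟩)
        simp [hp (y - x) (by omega)]
  calc ∑ y ∈ A, ∑' x, a x * p (y - x) * w x
      ≤ ∑ y ∈ A, (∑ x ∈ A, a x * w x * p (y - x) + (a b * p (y - b) +
          ENNReal.ofReal (Real.exp (2 * s)) * (2 * Ψ y))) := by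
        refine Finset.sum_le_sum fun y hy => ?_
        refine (ENNReal.tsum_le_tsum (hterm y hy)).trans ?_
        rw [ENNReal.tsum_add, ENNReal.tsum_add, ENNReal.tsum_mul_left, tsum_ite_eq]
        gcongr
        · rw [tsum_eq_sum (s := A) fun x hx => if_neg hx]
          exact Finset.sum_le_sum fun x hx => by rw [if_pos hx]
        · exact hΨ2 y
    _ ≤ _ := by
        rw [Finset.sum_add_distrib, Finset.sum_add_distrib, Finset.sum_comm]
        simp only [← Finset.mul_sum]
        gcongr
        exact mul_le_of_le_one_right zero_le (sum_apply_sub_le_one p A b)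

/-- The flux through the origin, restricted to the particles jumping from `0` and `-1`, is bounded
by the number of particles initially in `(b, 0]`, plus those coming from `b`, plus an error. -/
lemma IsZeroRangeProcess.flux_le
    (h : IsZeroRangeProcess g α p (fun x => (η₀ x : ℕ∞)) P η) (hc : 0 ≤ c)
    (hp : ∀ z ≤ 0, p z = 0) {b : ℤ} (hb : b < -1) {Ψ : ℤ → ℝ≥0∞}
    (hΨ : ∀ y < b, η₀ y ≠ 0 → 1 ≤ Ψ y)
    (hΨ2 : ∀ y, ∑' x, p (y - x) * Ψ x ≤ 2 * Ψ y) {t : ℝ} (ht : 0 ≤ t) :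
    ∫⁻ s in Set.Ioc 0 t, (ENNReal.ofReal (α.val 0) * meanRate g P η s 0 +
        ENNReal.ofReal (α.val (-1)) * meanRate g P η s (-1) * (1 - p 1)) ≤
      ∑ x ∈ Finset.Ioc b 0, (η₀ x : ℝ≥0∞) + ENNReal.ofReal (α.val b) * ENNReal.ofReal t +
        ENNReal.ofReal (Real.exp (2 * t)) * ∑ y ∈ Finset.Ioc b 0, Ψ y + 1 := by
  set A := Finset.Ioc b 0
  set w := meanRate g P η
  set a : ℤ → ℝ≥0∞ := fun x => ENNReal.ofReal (α.val x)
  set r : ℤ → ℝ≥0∞ := fun x => ∑ y ∈ A, p (y - x)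
  have ha : ∀ x, a x ≤ 1 := fun x => ENNReal.ofReal_le_one.2 (α.mem_Ioc x).2
  have hw : ∀ s x, w s x ≤ 1 := fun s x => meanRate_le_one g s x
  have hr : ∀ x, r x ≤ 1 := fun x => sum_apply_sub_le_one p A x
  have hwm : ∀ x, Measurable fun s => w s x := fun x => measurable_meanRate g h.measurable_path x
  -- a truncation level which makes the truncation error at most one
  obtain ⟨K, hK⟩ : ∃ K : ℕ, (∑ x ∈ A, (η₀ x + 2 * ENNReal.ofReal t)) * ENNReal.ofReal t < K :=
    ENNReal.exists_nat_gt (by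
      refine ENNReal.mul_ne_top (ENNReal.sum_ne_top.2 fun x _ => ?_) ENNReal.ofReal_ne_top
      finiteness)
  have hK0 : (K : ℝ≥0∞) ≠ 0 := (zero_le.trans_lt hK).ne'
  have hKt : (K : ℝ≥0∞) ≠ ⊤ := ENNReal.natCast_ne_top K
  set J : ℝ → ℝ≥0∞ := fun s => ∑ x ∈ A, a x * w s x * r x
  have hJm : Measurable J :=
    Finset.measurable_sum _ fun x _ => ((hwm x).const_mul _).mul_const _
  have hJfin : ∫⁻ s in Set.Ioc 0 t, J s ≠ ⊤ := by
    refine ne_top_of_le_ne_top (b := ∫⁻ _ in Set.Ioc 0 t, (A.card : ℝ≥0∞)) ?_ ?_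
    · simp only [lintegral_const, Measure.restrict_apply_univ, Real.volume_Ioc]
      finiteness
    · refine lintegral_mono fun s => ?_
      refine (Finset.sum_le_card_nsmul A _ 1 fun x _ => ?_).trans (by simp)
      exact mul_le_one' (mul_le_one' (ha x) (hw s x)) (hr x)
  set F : ℝ → ℝ≥0∞ := fun s => a 0 * w s 0 + a (-1) * w s (-1) * (1 - p 1)
  -- no jump from `0` ends in `A`, and those from `-1` do only if they have length one
  have hr0 : r 0 = 0 := Finset.sum_eq_zero fun y hy => hp _ (by
    have := Finset.mem_Ioc.1 hy; omega)
  have hr1 : r (-1) = p 1 := by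
    refine (Finset.sum_eq_single 0 (fun y hy hy0 => hp _ ?_) fun h0 => ?_).trans (by simp)
    · have := Finset.mem_Ioc.1 hy; omega
    · exact absurd (Finset.mem_Ioc.2 ⟨by omega, le_rfl⟩) h0
  have hFJ : ∀ s, J s + F s ≤ ∑ x ∈ A, a x * w s x := by
    intro s
    have h1 : ∀ x, a x * w s x = a x * w s x * r x + a x * w s x * (1 - r x) := fun x => by
      rw [← mul_add, add_tsub_cancel_of_le (hr x), mul_one]
    rw [Finset.sum_congr rfl fun x _ => h1 x, Finset.sum_add_distrib]
    refine add_le_add_right ?_ _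
    have h2 : ({0, -1} : Finset ℤ) ⊆ A := by
      intro x hx
      simp only [Finset.mem_insert, Finset.mem_singleton] at hx
      exact Finset.mem_Ioc.2 (by omega)
    refine le_trans (le_of_eq ?_) (Finset.sum_le_sum_of_subset h2)
    rw [Finset.sum_pair (by norm_num), hr0, hr1, tsub_zero, mul_one]
  have herr : ∀ s ∈ Set.Ioc 0 t, ∑ x ∈ A, P {ω | (K : ℕ∞) < η s.toNNReal ω x} ≤
      (∑ x ∈ A, (η₀ x + 2 * ENNReal.ofReal t)) / K := by
    intro s hs
    rw [ENNReal.le_div_iff_mul_le (Or.inl hK0) (Or.inl hKt), mul_comm, Finset.mul_sum]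
    refine Finset.sum_le_sum fun x _ => ?_
    refine (h.mul_measure_lt_le hc (hp 0 le_rfl) x K hs.1.le).trans ?_
    gcongr
    exact hs.2
  have hbal : (∫⁻ s in Set.Ioc 0 t, J s) + ∫⁻ s in Set.Ioc 0 t, F s ≤
      (∫⁻ s in Set.Ioc 0 t, J s) + (∑ x ∈ A, (η₀ x : ℝ≥0∞) + a b * ENNReal.ofReal t +
        ENNReal.ofReal (Real.exp (2 * t)) * ∑ y ∈ A, Ψ y + 1) := by
    calc (∫⁻ s in Set.Ioc 0 t, J s) + ∫⁻ s in Set.Ioc 0 t, F s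
        = ∫⁻ s in Set.Ioc 0 t, (J s + F s) := (lintegral_add_left hJm _).symm
      _ ≤ ∫⁻ s in Set.Ioc 0 t, ∑ x ∈ A, a x * w s x := lintegral_mono hFJ
      _ ≤ _ := (le_add_self).trans (h.boxCount_add_outflow_le hc (hp 0 le_rfl) A K ht)
      _ ≤ ∑ x ∈ A, (η₀ x : ℝ≥0∞) + ∫⁻ s in Set.Ioc 0 t, (J s + (a b +
            ENNReal.ofReal (Real.exp (2 * s)) * (2 * ∑ y ∈ A, Ψ y)) +
            (∑ x ∈ A, (η₀ x + 2 * ENNReal.ofReal t)) / K) := by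
          refine add_le_add (ofReal_boxCount_natCast_le A K η₀)
            (setLIntegral_mono' measurableSet_Ioc fun s hs => ?_)
          exact add_le_add (h.sum_inflow_le hc hp hΨ hΨ2 hs.1.le) (herr s hs)
      _ = ∑ x ∈ A, (η₀ x : ℝ≥0∞) + ((∫⁻ s in Set.Ioc 0 t, J s) + (a b * ENNReal.ofReal t +
            (∫⁻ s in Set.Ioc 0 t, ENNReal.ofReal (Real.exp (2 * s))) * (2 * ∑ y ∈ A, Ψ y)) +
            (∑ x ∈ A, (η₀ x + 2 * ENNReal.ofReal t)) / K * ENNReal.ofReal t) := by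
          rw [lintegral_add_right _ measurable_const, lintegral_add_left hJm,
            lintegral_add_left measurable_const, lintegral_mul_const _ (by fun_prop)]
          simp
      _ ≤ ∑ x ∈ A, (η₀ x : ℝ≥0∞) + ((∫⁻ s in Set.Ioc 0 t, J s) + (a b * ENNReal.ofReal t +
            ENNReal.ofReal (Real.exp (2 * t)) / 2 * (2 * ∑ y ∈ A, Ψ y)) + 1) := by
          gcongr
          · exact lintegral_exp_le ht
          · rw [← ENNReal.mul_div_right_comm]
            exact ENNReal.div_le_of_le_mul (by rw [one_mul]; exact hK.le)
      _ = _ := by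
          rw [← mul_assoc (_ / 2), ENNReal.div_mul_cancel two_ne_zero ENNReal.ofNat_ne_top]
          ring
  exact (ENNReal.add_le_add_iff_left hJfin).1 hbal

end

/-! ### Mean rates in the limit -/

lemma prod_rate_pos (g : RateFunction) (n : ℕ) : 0 < ∏ k ∈ Finset.Icc 1 n, g.rate k :=
  Finset.prod_pos fun _ hk => g.rate_pos (Finset.mem_Icc.1 hk).1

/-- Under `θ_λ` the mean of `g` is `λ`. -/
lemma lintegral_ext_theta (g : RateFunction) {lam : ℝ} (h0 : 0 ≤ lam) (h1 : lam < 1) :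
    ∫⁻ k, ENNReal.ofReal (g.ext k) ∂theta g lam = ENNReal.ofReal lam := by
  have hZ0 := partitionFunction_ne_zero g lam
  have hZ1 := partitionFunction_ne_top g h0 h1
  have hshift : ∀ n : ℕ, weight g lam (n + 1) * ENNReal.ofReal (g.rate (n + 1)) =
      ENNReal.ofReal lam * weight g lam n := fun n => by
    have hp := prod_rate_pos g n
    have hr := g.rate_pos (Nat.le_add_left 1 n)
    rw [weight, weight, ← ENNReal.ofReal_mul h0, ← ENNReal.ofReal_mul (div_nonneg
      (pow_nonneg h0 _) (prod_rate_pos g _).le), Finset.prod_Icc_succ_top (Nat.le_add_left 1 n)]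
    congr 1
    field_simp
    ring
  calc ∫⁻ k, ENNReal.ofReal (g.ext k) ∂theta g lam
      = ∑' n : ℕ, weight g lam n / partitionFunction g lam * ENNReal.ofReal (g.rate n) := by
        rw [theta, lintegral_sum_measure]
        refine tsum_congr fun n => ?_
        rw [lintegral_smul_measure, lintegral_dirac, g.ext_natCast, smul_eq_mul]
    _ = ∑' n : ℕ, weight g lam (n + 1) / partitionFunction g lam *
          ENNReal.ofReal (g.rate (n + 1)) := by
        rw [tsum_eq_zero_add' ENNReal.summable]
        simp [g.rate_zero]
    _ = ENNReal.ofReal lam * (partitionFunction g lam)⁻¹ * ∑' n, weight g lam n := by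
        rw [← ENNReal.tsum_mul_left]
        refine tsum_congr fun n => ?_
        rw [div_eq_mul_inv, mul_right_comm, hshift]
        ring
    _ = ENNReal.ofReal lam := by
        rw [mul_assoc, ← partitionFunction, ENNReal.inv_mul_cancel hZ0 hZ1, mul_one]

/-- If the process converges in law to `μ_c^α`, the mean rate at `x` converges to `c / α(x)`. -/
lemma tendsto_meanRate {Ω : Type*} [MeasurableSpace Ω] {P : Measure Ω} [IsProbabilityMeasure P]
    {η : ℝ≥0 → Ω → Config} (g : RateFunction) {c : ℝ} (hc : c ∈ Set.Ioo (0 : ℝ) 1)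
    (α : Environment c)
    (h : TendstoInDistribution η atTop id (fun _ => P)
      (invariantMeasure g hc α c ⟨hc.1.le, le_rfl⟩ : Measure Config)) (x : ℤ) :
    Tendsto (fun s => meanRate g P η s x) atTop (𝓝 (ENNReal.ofReal (c / α.val x))) := by
  have hcont : Continuous fun ζ : Config => (g.ext (ζ x)).toNNReal :=
    continuous_real_toNNReal.comp (g.continuous_ext.comp (continuous_apply x))
  let F : BoundedContinuousFunction Config ℝ≥0 :=
    BoundedContinuousFunction.mkOfBound ⟨_, hcont⟩ 1 fun ζ ξ => by
      simp only [ContinuousMap.coe_mk, NNReal.dist_eq, Real.coe_toNNReal _ (g.ext_nonneg _)]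
      rw [abs_le]
      constructor <;> linarith [g.ext_nonneg (ζ x), g.ext_nonneg (ξ x), g.ext_le_one (ζ x),
        g.ext_le_one (ξ x)]
  have hFm : Measurable fun ζ : Config => (F ζ : ℝ≥0∞) :=
    (measurable_ext_apply g x).ennreal_ofReal
  have h1 := (ProbabilityMeasure.tendsto_iff_forall_lintegral_tendsto.1 h.tendsto) F
  simp only [ProbabilityMeasure.coe_mk, Measure.map_id] at h1
  have h2 : ∫⁻ ζ, F ζ ∂(invariantMeasure g hc α c ⟨hc.1.le, le_rfl⟩ : Measure Config) =
      ENNReal.ofReal (c / α.val x) := by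
    have hpos : ∀ x, 0 < α.val x := fun x => hc.1.trans (α.mem_Ioc x).1
    have hlt : ∀ x, c / α.val x < 1 := fun x => (div_lt_one (hpos x)).2 (α.mem_Ioc x).1
    have hprob : ∀ x, IsProbabilityMeasure (theta g (c / α.val x)) := fun x =>
      isProbabilityMeasure_theta g (div_nonneg hc.1.le (hpos x).le) (hlt x)
    rw [← lintegral_ext_theta g (div_nonneg hc.1.le (hpos x).le) (hlt x),
      ← Measure.infinitePi_map_eval (fun x => theta g (c / α.val x)) x,
      lintegral_map Measurable.of_discrete (measurable_pi_apply x)]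
    rfl
  rw [h2] at h1
  refine (h1.comp tendsto_real_toNNReal_atTop).congr fun s => ?_
  exact lintegral_map' hFm.aemeasurable (h.forall_aemeasurable _)

/-! ### The initial configuration -/

/-- Sites for the piles: each of them is close to being slowest, and so far to the left that
particles starting there have little effect on `(-m, 0]` up to time `(m + 1) ^ 4`, for every `m` up to
the previous one. -/
lemma exists_pile_sites {c : ℝ} (α : Environment c) (p : PMF ℤ)
    (hα : liminf α.val atBot = c) :
    ∃ d : ℕ → ℕ, StrictMono d ∧ 2 ≤ d 0 ∧
      (∀ k, α.val (-(d (k + 1) : ℤ)) < c + 1 / ((d k : ℝ) + 1)) ∧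
      ∀ k, ∀ m ≤ d k, ENNReal.ofReal (Real.exp (2 * ((m : ℝ) + 1) ^ 4)) *
        ∑ y ∈ Finset.Ioc (-(m : ℤ)) 0, green p (y + d (k + 1)) ≤ 2⁻¹ ^ d k := by
  have hnext : ∀ d : ℕ, ∃ d' : ℕ, d < d' ∧ α.val (-(d' : ℤ)) < c + 1 / ((d : ℝ) + 1) ∧
      ∀ m ≤ d, ENNReal.ofReal (Real.exp (2 * ((m : ℝ) + 1) ^ 4)) *
        ∑ y ∈ Finset.Ioc (-(m : ℤ)) 0, green p (y + d') ≤ 2⁻¹ ^ d := by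
    intro d
    have hbdd : IsBoundedUnder (· ≤ ·) atBot α.val :=
      ⟨1, eventually_map.2 (Eventually.of_forall fun x => (α.mem_Ioc x).2)⟩
    have h1 : ∃ᶠ x in atBot, α.val x < c + 1 / ((d : ℝ) + 1) := by
      refine frequently_lt_of_liminf_lt hbdd.isCoboundedUnder_ge ?_
      rw [hα]
      have : 0 < 1 / ((d : ℝ) + 1) := by positivity
      linarith
    have hG : ∀ y : ℤ, Tendsto (fun x : ℤ => green p (y - x)) atBot (𝓝 0) := fun y => by
      have hinj : Function.Injective fun x : ℤ => y - x := sub_right_injective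
      refine ((tendsto_green p).comp hinj.tendsto_cofinite).mono_left ?_
      rw [Int.cofinite_eq]
      exact le_sup_left
    have h2 : ∀ᶠ x : ℤ in atBot, ∀ m ∈ Set.Iic d,
        ENNReal.ofReal (Real.exp (2 * ((m : ℝ) + 1) ^ 4)) *
          ∑ y ∈ Finset.Ioc (-(m : ℤ)) 0, green p (y - x) ≤ 2⁻¹ ^ d := by
      refine (Filter.eventually_all_finite (Set.finite_Iic d)).2 fun m _ => ?_
      have hsum : Tendsto (fun x : ℤ => ENNReal.ofReal (Real.exp (2 * ((m : ℝ) + 1) ^ 4)) *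
          ∑ y ∈ Finset.Ioc (-(m : ℤ)) 0, green p (y - x)) atBot (𝓝 0) := by
        have := ENNReal.Tendsto.const_mul
          (a := ENNReal.ofReal (Real.exp (2 * ((m : ℝ) + 1) ^ 4)))
          (tendsto_finsetSum (Finset.Ioc (-(m : ℤ)) 0) fun y _ => hG y)
          (Or.inr ENNReal.ofReal_ne_top)
        simpa using this
      refine hsum.eventually_le_const ?_
      exact ENNReal.pow_pos (ENNReal.inv_pos.2 ENNReal.ofNat_ne_top) d
    obtain ⟨x, hx1, hx2, hx3⟩ := (h1.and_eventually
      (h2.and (eventually_lt_atBot (-(d : ℤ))))).exists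
    have hx : ((-x).toNat : ℤ) = -x := Int.toNat_of_nonneg (by omega)
    refine ⟨(-x).toNat, by omega, by rwa [hx, neg_neg], fun m hm => ?_⟩
    simp only [hx, ← sub_eq_add_neg]
    exact hx2 m hm
  choose f hf using hnext
  have hsucc : ∀ k, f^[k + 1] 2 = f (f^[k] 2) := fun k => Function.iterate_succ_apply' f k 2
  refine ⟨fun k => f^[k] 2, strictMono_nat_of_lt_succ fun k => ?_, le_rfl, fun k => ?_,
    fun k m hm => ?_⟩
  · simp only [hsucc]
    exact (hf _).1
  · simp only [hsucc]
    exact (hf _).2.1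
  · simp only [hsucc]
    exact (hf _).2.2 m hm

/-- The initial configuration with `d k * d (k + 1)` particles at `-d k` for every `k`, and no other
particles. -/
def piles (d : ℕ → ℕ) : ℤ → ℕ :=
  Function.extend (fun k => -(d k : ℤ)) (fun k => d k * d (k + 1)) 0

section

variable {d : ℕ → ℕ}

lemma piles_apply (hd : StrictMono d) (k : ℕ) : piles d (-(d k : ℤ)) = d k * d (k + 1) := by
  have hinj : Function.Injective fun k => -(d k : ℤ) := fun i j h => hd.injective (by simpa using h)
  exact hinj.extend_apply _ _ k

lemma exists_of_piles_ne_zero {y : ℤ} (hy : piles d y ≠ 0) : ∃ k, y = -(d k : ℤ) := by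
  by_contra h
  exact hy (Function.extend_apply' _ _ _ fun ⟨k, hk⟩ => h ⟨k, hk.symm⟩)

lemma sum_piles_le (hd : StrictMono d) (k : ℕ) :
    ∑ x ∈ Finset.Ioc (-(d k : ℤ)) 0, (piles d x : ℝ≥0∞) ≤ ((d k ^ 3 : ℕ) : ℝ≥0∞) := by
  have h : ∀ x ∈ Finset.Ioc (-(d k : ℤ)) 0, piles d x ≤ d k * d k := by
    intro x hx
    by_cases h0 : piles d x = 0
    · simp [h0]
    obtain ⟨j, rfl⟩ := exists_of_piles_ne_zero h0
    have hjk : d j < d k := by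
      have := (Finset.mem_Ioc.1 hx).1
      omega
    rw [piles_apply hd]
    exact Nat.mul_le_mul hjk.le (hd.monotone (Nat.succ_le_of_lt (hd.lt_iff_lt.1 hjk)))
  have h2 := Finset.sum_le_card_nsmul _ _ _ h
  rw [Int.card_Ioc, smul_eq_mul] at h2
  have h3 : ((0 - -(d k : ℤ)).toNat) = d k := by simp
  rw [h3] at h2
  rw [← Nat.cast_sum]
  exact_mod_cast h2.trans (le_of_eq (by ring))

/-- The empirical density of `piles d` to the left of the origin is infinite. -/
lemma tendsto_density_piles (hd : StrictMono d) :
    Tendsto (fun n : ℕ => (∑ x ∈ Finset.Icc (-(n : ℤ)) (-1), (piles d x : ℝ≥0∞)) / n) atTop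
      (𝓝 ⊤) := by
  refine ENNReal.tendsto_nhds_top fun k => ?_
  filter_upwards [eventually_ge_atTop (d (k + 1))] with n hn
  have hex : ∃ j, n < d j := ⟨n + 1, hd.id_le (n + 1)⟩
  obtain ⟨j, hj⟩ : ∃ j, Nat.find hex = j + 1 := Nat.exists_eq_succ_of_ne_zero fun h0 => by
    have h1 := Nat.find_spec hex
    rw [h0] at h1
    exact absurd (h1.trans_le (hd.monotone (Nat.zero_le (k + 1)))) (not_lt.2 hn)
  have h1 : n < d (j + 1) := hj ▸ Nat.find_spec hex
  have h2 : d j ≤ n := not_lt.1 (Nat.find_min hex (by omega))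
  have h3 : k < j := Nat.lt_of_succ_lt_succ (hd.lt_iff_lt.1 (hn.trans_lt h1))
  have h4 : j ≤ d j := hd.id_le j
  have hmem : -(d j : ℤ) ∈ Finset.Icc (-(n : ℤ)) (-1) := Finset.mem_Icc.2 (by omega)
  have hn0 : (n : ℝ≥0∞) ≠ 0 := by
    have : n ≠ 0 := by omega
    exact_mod_cast this
  rw [ENNReal.lt_div_iff_mul_lt (Or.inl hn0) (Or.inl (ENNReal.natCast_ne_top n))]
  refine lt_of_lt_of_le ?_ (Finset.single_le_sum (f := fun x => (piles d x : ℝ≥0∞))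
    (fun _ _ => zero_le) hmem)
  simp only [piles_apply hd]
  exact_mod_cast Nat.mul_lt_mul_of_lt_of_le' (h3.trans_le h4) h1.le (by omega)

end

/-! ### The contradiction -/

/-- For the process started from the piles, the flux through the origin up to time
`(d k + 1) ^ 4` is at most what the site `-d k` alone can emit, plus a number of
particles which is negligible compared with `(d k + 1) ^ 4`. -/
lemma flux_le_of_piles {Ω : Type*} [MeasurableSpace Ω] {P : Measure Ω} [IsProbabilityMeasure P]
    {η : ℝ≥0 → Ω → Config} {g : RateFunction} {c : ℝ} (hc : 0 ≤ c) {α : Environment c}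
    {p : PMF ℤ} (hp : ∀ z ≤ 0, p z = 0) {d : ℕ → ℕ} (hd : StrictMono d) (hd0 : 2 ≤ d 0)
    (hfar : ∀ k, ∀ m ≤ d k, ENNReal.ofReal (Real.exp (2 * ((m : ℝ) + 1) ^ 4)) *
      ∑ y ∈ Finset.Ioc (-(m : ℤ)) 0, green p (y + d (k + 1)) ≤ 2⁻¹ ^ d k)
    (h : IsZeroRangeProcess g α p (fun x => (piles d x : ℕ∞)) P η) (k : ℕ) :
    ∫⁻ s in Set.Ioc 0 (((d k : ℝ) + 1) ^ 4), (ENNReal.ofReal (α.val 0) * meanRate g P η s 0 +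
        ENNReal.ofReal (α.val (-1)) * meanRate g P η s (-1) * (1 - p 1)) ≤
      ENNReal.ofReal ((d k : ℝ) ^ 3 + α.val (-(d k : ℤ)) * ((d k : ℝ) + 1) ^ 4 + 3) := by
  have hd2 : 2 ≤ d k := hd0.trans (hd.monotone (Nat.zero_le k))
  have hΨ : ∀ y < -(d k : ℤ), piles d y ≠ 0 → 1 ≤ ∑' j, green p (y + d (k + j + 1)) := by
    intro y hy h0
    obtain ⟨i, rfl⟩ := exists_of_piles_ne_zero h0
    have hki : k < i := hd.lt_iff_lt.1 (by omega)
    obtain ⟨j, rfl⟩ := Nat.exists_eq_add_of_lt hki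
    refine le_trans ?_ (ENNReal.le_tsum j)
    rw [neg_add_cancel]
    exact one_le_green_zero p
  have herr : ENNReal.ofReal (Real.exp (2 * ((d k : ℝ) + 1) ^ 4)) *
      ∑ y ∈ Finset.Ioc (-(d k : ℤ)) 0, ∑' j, green p (y + d (k + j + 1)) ≤ 2 := by
    calc _ = ∑' j, ENNReal.ofReal (Real.exp (2 * ((d k : ℝ) + 1) ^ 4)) *
          ∑ y ∈ Finset.Ioc (-(d k : ℤ)) 0, green p (y + d (k + j + 1)) := by
          rw [ENNReal.tsum_mul_left, Summable.tsum_finsetSum fun _ _ => ENNReal.summable]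
      _ ≤ ∑' j : ℕ, 2⁻¹ ^ j := by
          refine ENNReal.tsum_le_tsum fun j => ?_
          refine (hfar (k + j) (d k) (hd.monotone (Nat.le_add_right k j))).trans ?_
          exact pow_le_pow_right_of_le_one' (ENNReal.inv_le_one.2 ENNReal.one_lt_two.le)
            ((Nat.le_add_left j k).trans (hd.id_le _))
      _ = 2 := by
          rw [ENNReal.tsum_geometric, ENNReal.one_sub_inv_two, inv_inv]
  have hα0 : 0 ≤ α.val (-(d k : ℤ)) := hc.trans (α.mem_Ioc _).1.le
  have hT : 0 ≤ ((d k : ℝ) + 1) ^ 4 := by positivity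
  have := h.flux_le hc hp (b := -(d k : ℤ)) (by omega) hΨ
    (tsum_mul_tsum_green_le p fun j => (d (k + j + 1) : ℤ)) hT
  refine this.trans ?_
  calc _ ≤ ((d k ^ 3 : ℕ) : ℝ≥0∞) +
        ENNReal.ofReal (α.val (-(d k : ℤ))) * ENNReal.ofReal (((d k : ℝ) + 1) ^ 4) + 2 + 1 := by
        gcongr
        exact sum_piles_le hd k
    _ = _ := by
        rw [ENNReal.ofReal_add (by positivity) (by norm_num), ENNReal.ofReal_add (by positivity)
          (by positivity), ENNReal.ofReal_mul hα0, add_assoc _ 2 1]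
        congr 2
        · rw [← ENNReal.ofReal_natCast, Nat.cast_pow]
        · norm_num

end

end ZeroRange

theorem theorem2p3 {c : ℝ} (hc : c ∈ Set.Ioo (0 : ℝ) 1)
    (g : ZeroRange.RateFunction) (α : ZeroRange.Environment c) (p : PMF ℤ)
    (hliminf : liminf α.val atBot = c)
    (hdensity : ZeroRange.HasAnnealedDensity g α)
    (hasym : ∀ z : ℤ, z ≤ 0 → p z = 0)
    (hp1 : p 1 < 1) :
    ∃ η₀ : ℤ → ℕ, ZeroRange.IsSupercritical g α η₀ ∧
      ∀ {Ω : Type*} [MeasurableSpace Ω] (P : Measure Ω) [IsProbabilityMeasure P]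
        (η : ℝ≥0 → Ω → ZeroRange.Config),
        ZeroRange.IsZeroRangeProcess g α p (fun x => (η₀ x : ℕ∞)) P η →
        ¬ TendstoInDistribution η atTop id (fun _ => P)
            (ZeroRange.invariantMeasure g hc α c ⟨hc.1.le, le_rfl⟩ : Measure ZeroRange.Config) := by
  obtain ⟨d, hd, hd0, hslow, hfar⟩ := ZeroRange.exists_pile_sites α p hliminf
  refine ⟨ZeroRange.piles d, ?_, ?_⟩
  · rw [ZeroRange.IsSupercritical, (ZeroRange.tendsto_density_piles hd).liminf_eq]
    exact le_top
  intro Ω _ P _ η h hconv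
  set F : ℝ → ℝ≥0∞ := fun s => ENNReal.ofReal (α.val 0) * ZeroRange.meanRate g P η s 0 +
    ENNReal.ofReal (α.val (-1)) * ZeroRange.meanRate g P η s (-1) * (1 - p 1)
  set q : ℝ := (1 - p 1).toReal
  have hq1 : 1 - p 1 ≠ ⊤ := ENNReal.sub_ne_top ENNReal.one_ne_top
  have hq : 0 < q := ENNReal.toReal_pos (tsub_pos_of_lt hp1).ne' hq1
  have hpos : ∀ x, 0 < α.val x := fun x => hc.1.trans (α.mem_Ioc x).1
  have hlim : Tendsto F atTop (𝓝 (ENNReal.ofReal (c * (1 + q)))) := by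
    have hx : ∀ x, Tendsto (fun s => ENNReal.ofReal (α.val x) * ZeroRange.meanRate g P η s x) atTop
        (𝓝 (ENNReal.ofReal c)) := fun x => by
      have h1 := ENNReal.Tendsto.const_mul (a := ENNReal.ofReal (α.val x))
        (ZeroRange.tendsto_meanRate g hc α hconv x) (Or.inr ENNReal.ofReal_ne_top)
      rwa [← ENNReal.ofReal_mul (hpos x).le, mul_div_cancel₀ _ (hpos x).ne'] at h1
    have h2 := (hx 0).add (ENNReal.Tendsto.mul_const (hx (-1)) (Or.inr hq1))
    have h3 : ENNReal.ofReal (c * (1 + q)) =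
        ENNReal.ofReal c + ENNReal.ofReal c * (1 - p 1) := by
      rw [← ENNReal.ofReal_toReal hq1, ← ENNReal.ofReal_mul hc.1.le,
        ← ENNReal.ofReal_add hc.1.le (mul_nonneg hc.1.le hq.le), mul_add, mul_one]
    rw [h3]
    exact h2
  -- a rate strictly between the asymptotic emission rate `c` of a pile and the equilibrium flux
  obtain ⟨c', hcc', hc'⟩ := exists_between (show c < c * (1 + q) by nlinarith [hc.1])
  have hc'0 : 0 < c' := hc.1.trans hcc'
  obtain ⟨S, hS⟩ := eventually_atTop.1 ((hlim.eventually_const_lt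
    ((ENNReal.ofReal_lt_ofReal_iff (hc'0.trans hc')).2 hc')).and (eventually_ge_atTop (0 : ℝ)))
  have hS0 : 0 ≤ S := (hS S le_rfl).2
  obtain ⟨k, hk⟩ := exists_nat_gt ((5 + c' * S) / (c' - c))
  rw [div_lt_iff₀ (sub_pos.2 hcc')] at hk
  set T : ℝ := ((d (k + 1) : ℝ) + 1) ^ 4
  have hT : 0 ≤ T := by positivity
  have hflux := ZeroRange.flux_le_of_piles hc.1.le hasym hd hd0 hfar h (k + 1)
  have hlow : ENNReal.ofReal (c' * (T - S)) ≤ ∫⁻ s in Set.Ioc 0 T, F s := by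
    calc ENNReal.ofReal (c' * (T - S)) = ∫⁻ _ in Set.Ioc S T, ENNReal.ofReal c' := by
          rw [setLIntegral_const, Real.volume_Ioc, ENNReal.ofReal_mul hc'0.le]
      _ ≤ ∫⁻ s in Set.Ioc S T, F s :=
          setLIntegral_mono' measurableSet_Ioc fun s hs => (hS s hs.1.le).1.le
      _ ≤ _ := lintegral_mono_set (Set.Ioc_subset_Ioc_left hS0)
  have hreal : c' * (T - S) ≤ (d (k + 1) : ℝ) ^ 3 + α.val (-(d (k + 1) : ℤ)) * T + 3 :=
    (ENNReal.ofReal_le_ofReal_iff (by have := hpos (-(d (k + 1) : ℤ)); positivity)).1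
      (hlow.trans hflux)
  -- every correction is at most a constant multiple of `T / (k + 1)`
  have hk1 : (0 : ℝ) < (k : ℝ) + 1 := by positivity
  have hdk : (k : ℝ) + 1 ≤ (d k : ℝ) + 1 := by
    have := hd.id_le k
    gcongr
    exact this
  have hdk1 : (k : ℝ) + 1 ≤ (d (k + 1) : ℝ) + 1 := by
    have : k ≤ d (k + 1) := (Nat.le_succ k).trans (hd.id_le (k + 1))
    gcongr
  have hD : (0 : ℝ) ≤ d (k + 1) := Nat.cast_nonneg _
  have hα1 : α.val (-(d (k + 1) : ℤ)) ≤ c + 1 / ((k : ℝ) + 1) :=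
    (hslow k).le.trans (by gcongr)
  have e1 : ((k : ℝ) + 1) * (d (k + 1) : ℝ) ^ 3 ≤ T := by
    calc ((k : ℝ) + 1) * (d (k + 1) : ℝ) ^ 3
        ≤ ((d (k + 1) : ℝ) + 1) * ((d (k + 1) : ℝ) + 1) ^ 3 := by gcongr; linarith
      _ = T := by ring
  have e2 : (k : ℝ) + 1 ≤ T := by
    calc (k : ℝ) + 1 ≤ (d (k + 1) : ℝ) + 1 := hdk1
      _ ≤ T := le_self_pow₀ (by linarith) (by norm_num)
  have e3 : ((k : ℝ) + 1) * (α.val (-(d (k + 1) : ℤ)) * T) ≤ ((k : ℝ) + 1) * (c * T) + T := by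
    calc ((k : ℝ) + 1) * (α.val (-(d (k + 1) : ℤ)) * T)
        ≤ ((k : ℝ) + 1) * ((c + 1 / ((k : ℝ) + 1)) * T) := by gcongr
      _ = _ := by field_simp
  have e4 := mul_le_mul_of_nonneg_left hreal hk1.le
  have e5 : ((k : ℝ) + 1) * (3 + c' * S) ≤ T * (3 + c' * S) :=
    mul_le_mul_of_nonneg_right e2 (by positivity)
  have e6 : ((k : ℝ) + 1) * (c' - c) * T ≤ (5 + c' * S) * T := by nlinarith
  have e7 : ((k : ℝ) + 1) * (c' - c) ≤ 5 + c' * S :=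
    le_of_mul_le_mul_right e6 (hk1.trans_le e2)
  nlinarith
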